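/- **Setting.** Let $\mathbb B$ be a (real) Banach lattice with positive cone $\mathbb B_+$, $N=\{1,\dots,n\}$ ($n\ge 1$) a finite set of agents, $\mathscr Y$ a set of public projects and $c:\mathscr Y\to\mathbb B_+$ a cost function. Agent $i$ has an endowment $e_i\in\mathbb B_+$ and a utility function $u_i:\mathbb B_+\times\mathscr Y\to\mathbb R$ such that, for each $z$, $u_i(\cdot,z)$ is continuous, quasi-concave and strongly monotone ($\xi\ge\zeta$, $\xi\ne\zeta$ imply $u_i(\xi,z)>u_i(\zeta,z)$). Put $\mathbf e=\sum_i e_i$. For $w\in\mathbb B$ let $L(w)=\{v:|v|\le r|w|\text{ for some }r\ge0\}$ be the principal ideal generated by $w$; $w\in\mathbb B_+$ is a quasi-interior point of $\mathbb B_+$ if $L(w)$ is norm dense in $\mathbb B$. Write $w\gg0$ if: $w\in\operatorname{int}\mathbb B_+$, when $\operatorname{int}\mathbb B_+\neq\emptyset$; $w$ is a quasi-interior point of $\mathbb B_+$, when $\operatorname{int}\mathbb B_+=\emptyset$ but $\mathbb B_+$ has quasi-interior points; $w$ is a quasi-interior point of the positive cone of the Banach lattice $\overline{L(\mathbf e)}$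 (that is, $0\le w\in\overline{L(\mathbf e)}$ and $\overline{L(w)}\supseteq \overline{L(\mathbf e)}$), when $\mathbb B_+$ has no quasi-interior point. It is assumed that $\mathbf e\gg0$ and $\mathbf e-c(y)\gg0$ for all $y\in\mathscr Y$. An allocation $(x_1,\dots,x_n,y)$ (with $x_i\in\mathbb B_+$, $y\in\mathscr Y$) is *feasible* if $\sum_i x_i+c(y)=\mathbf e$. A feasible allocation $(x,y)$ is *Pareto optimal* if there is no feasible $(\xi,z)$ with $u_i(\xi_i,z)>u_i(x_i,y)$ for all $i$. Put $P_i^z(x_i,y)=\{\xi\in\mathbb B_+:u_i(\xi,z)>u_i(x_i,y)\}$. Standing assumptions: - *Essentiality:* for all $(x,y)$, $z$, $i$ there is $\xi\in\mathbb B_+$ with $u_i(\xi,z)\ge u_i(x_i,y)$; and $u_i(\xi,y)\ge u_i(0,z)$ for all $i$, $\xi\in\mathbb B_+$, $y,z\in\mathscr Y$. - *Integrable utilities:* for every feasible $(x,y)$ and every $z$ such that $P_i^z(x_i,y)\ne\emptyset$ for all $i$, there is a feasible $(\xi,z)$ with $u_i(\xi_i,z)\ge u_i(x_i,y)$ for all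 $i$. - One of: (1) $\operatorname{int}\mathbb B_+\ne\emptyset$; (2) $\operatorname{int}\mathbb B_+=\emptyset$, $\mathbb B_+$ has a quasi-interior point, and for every Pareto optimal $(x,y)$, every $i$ and every $z$ there is a convex $Q\subseteq\mathbb B$ with nonempty norm interior, $Q\cap\mathbb B_+=P_i^z(x_i,y)$ and $\operatorname{int}Q\cap\mathbb B_+\neq\emptyset$; (3) $\mathbb B_+$ has no quasi-interior point and, for every Pareto optimal $(x,y)$, every $i$ and every $z$, there is a convex $Q\subseteq\mathbb B$ with nonempty norm interior, $Q\cap\mathbb B_+=P_i^z(x_i,y)$ and $\operatorname{int}Q\cap\mathbb B_+\cap L(\mathbf e)\ne\emptyset$. A *contribution measure* $\sigma$ assigns to each nonempty coalition $S\subseteq N$ and each $z\in\mathscr Y$ a number $\sigma(S,z)\in[0,1]$, additively over disjoint coalitions, with $\sigma(N,z)=1$. Its cost distribution function is $\rho(i,z)=\sigma(\{i\},z)$. **Theorem.** Let $\sigma$ be a contribution measure with cost distribution function $\rho$ such that $e_i-\sigma(\{i\},z)c(z)\gg0$ for all $i\in N$, $z\in\mathscr Y$. Let $(x_1,\dots,x_n,y)$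 be a Pareto optimal allocation and, for each $z\in\mathscr Y$, let $(\gamma_1^z,\dots,\gamma_n^z,z)$ be a feasible allocation with $u_i(\gamma_i^z,z)\ge u_i(x_i,y)$ for all $i$. Then the following are equivalent. (i) $(x,y)$ is a cost share equilibrium for $\rho$: there are positive functionals $\pi(z)\in\mathbb B^*_+$ ($z\in\mathscr Y$) such that, for each $i$, $(x_i,y)$ maximizes $u_i$ on $\{(\zeta,z)\in\mathbb B_+\times\mathscr Y:\pi(z)\cdot\zeta+\rho(i,z)\,\pi(z)\cdot c(z)\le\pi(z)\cdot e_i\}$ (and belongs to this set). (ii) $(x,y)$ is in the $\sigma$-Aubin core: there are no $\gamma\in[0,1]^n\setminus\{0\}$, $z\in\mathscr Y$ and $\xi_1,\dots,\xi_n\in\mathbb B_+$ with $u_i(\xi_i,z)>u_i(x_i,y)$ whenever $\gamma_i>0$ and $\sum_i\gamma_i\xi_i+\big(\sum_i\gamma_i\sigma(\{i\},z)\big)c(z)=\sum_i\gamma_ie_i$. (iii) $(x,y)$ is Aubin non-dominated: there are no such $\gamma,z,\xi$ with $\gamma_i>0$ for all $i\in N$. (iv) $(x,y)$ is a $\sigma$-Edgeworth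 equilibrium: for each integer $r\ge1$, the equal treatment allocation giving $x_i$ to each agent $(i,j)$, with project $y$, is in the core of the $r$-fold replica economy (agents $(i,j)$, $1\le j\le r$, with $e_{(i,j)}=e_i$, $u_{(i,j)}=u_i$, cost function $rc$) for the contribution measure with $\sigma_r(\{(i,j)\},z)=\sigma(\{i\},z)/r$; that is, it is feasible there, and there are no nonempty set $C$ of agents, $z\in\mathscr Y$ and $\xi_{(i,j)}\in\mathbb B_+$ with $u_i(\xi_{(i,j)},z)>u_i(x_i,y)$ for $(i,j)\in C$ and $\sum_{C}\xi_{(i,j)}+\sigma_r(C,z)\,rc(z)=\sum_{C}e_i$. (v) For every $z\in\mathscr Y$ and every $\alpha\in[0,1]^n$, $(x,y)$ is not $z$-dominated by the grand coalition in the economy $\mathscr E(\gamma^z,z,\alpha)$ with endowments $\alpha_ie_i+(1-\alpha_i)[\gamma_i^z+\rho(i,z)c(z)]$ and cost function $c$: there are no $\xi_1,\dots,\xi_n\in\mathbb B_+$ with $\sum_i\xi_i+c(z)=\sum_i\big(\alpha_ie_i+(1-\alpha_i)[\gamma_i^z+\rho(i,z)c(z)]\big)$ and $u_i(\xi_i,z)>u_i(x_i,y)$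 for all $i$. -/

import Mathlib

/-! ### Banach lattice notions -/

/-- The principal order ideal generated by `w`. -/
def principalIdeal {B : Type*} [AddCommGroup B] [Lattice B] [Module ℝ B] (w : B) : Set B :=
  {x | ∃ r : ℝ, |x| ≤ r • |w|}

/-- A quasi-interior point of the positive cone: a positive element whose principal ideal is
norm dense. -/
def IsQuasiInteriorPoint {B : Type*} [NormedAddCommGroup B] [Lattice B] [NormedSpace ℝ B]
    (w : B) : Prop :=
  0 ≤ w ∧ Dense (principalIdeal w)

/-- `w` is a quasi-interior point of the positive cone of the Banach lattice
`closure (principalIdeal a)` (the closed ideal generated by `a`). -/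
def IsQuasiInteriorPointOfIdeal {B : Type*} [NormedAddCommGroup B] [Lattice B] [NormedSpace ℝ B]
    (a w : B) : Prop :=
  0 ≤ w ∧ w ∈ closure (principalIdeal a) ∧
    closure (principalIdeal a) ⊆ closure (principalIdeal w)

/-! ### Economies with public projects -/

/-- The data of an economy with set of agents `N`, set of public projects `Y` and private
commodity space `B`.  Utilities are only ever evaluated at bundles in the positive cone. -/
structure PublicEconomy (N Y B : Type*) where
  /-- initial endowments -/
  endow : N → B
  /-- cost function of the public projects -/
  cost : Y → B
  /-- utility functions -/
  util : N → B → Y → ℝ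

/-- A cost distribution function `ρ`: agent `i` pays the fraction `ρ i y` of the cost of `y`. -/
def IsCostDistribution {N Y : Type*} [Fintype N] (ρ : N → Y → ℝ) : Prop :=
  (∀ i y, ρ i y ∈ Set.Icc (0 : ℝ) 1) ∧ ∀ y, ∑ i, ρ i y = 1

/-- A contribution measure: an additive `[0,1]`-valued function of (nonempty) coalitions, for each
public project, with value one at the grand coalition. The value at `∅` is irrelevant. -/
structure IsContributionMeasure {N Y : Type*} [Fintype N] [DecidableEq N]
    (σ : Finset N → Y → ℝ) : Prop where
  mem_Icc : ∀ S, S.Nonempty → ∀ y, σ S y ∈ Set.Icc (0 : ℝ) 1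
  additive : ∀ S T, S.Nonempty → T.Nonempty → Disjoint S T →
    ∀ y, σ (S ∪ T) y = σ S y + σ T y
  univ_eq_one : ∀ y, σ Finset.univ y = 1

/-- The cost distribution function corresponding to a contribution measure. -/
def costDistributionOf {N Y : Type*} (σ : Finset N → Y → ℝ) (i : N) (y : Y) : ℝ := σ {i} y

namespace PublicEconomy

section Order

variable {N Y B : Type*} [Fintype N] [NormedAddCommGroup B] [Lattice B] [NormedSpace ℝ B]

/-- Total initial endowment. -/
def total (E : PublicEconomy N Y B) : B := ∑ i, E.endow i

/-- The relation `w ≫ 0`.  It means that `w` is an interior point of the positive cone if that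
cone has interior points; a quasi-interior point of the positive cone if the cone has empty
interior but has quasi-interior points; and, if the cone has no quasi-interior point, a
quasi-interior point of the positive cone of the closed ideal generated by the total endowment. -/
def StrictlyPositive (E : PublicEconomy N Y B) (w : B) : Prop :=
  w ∈ interior (Set.Ici (0 : B)) ∨
  (interior (Set.Ici (0 : B)) = ∅ ∧ IsQuasiInteriorPoint w) ∨
  ((¬ ∃ v : B, IsQuasiInteriorPoint v) ∧ IsQuasiInteriorPointOfIdeal E.total w)

/-- The desirable utilities (continuous, strongly monotone and quasi-concave in the private
goods). -/
structure Desirable (E : PublicEconomy N Y B) : Prop where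
  continuous : ∀ i z, ContinuousOn (fun ξ => E.util i ξ z) (Set.Ici 0)
  strongly_monotone : ∀ i z, ∀ ξ ζ : B, 0 ≤ ζ → ζ ≤ ξ → ξ ≠ ζ → E.util i ζ z < E.util i ξ z
  quasiconcave : ∀ i z, QuasiconcaveOn ℝ (Set.Ici 0) (fun ξ => E.util i ξ z)

/-- The conditions that make the data an economy with (non-Samuelsonian) public goods. -/
structure IsEconomy (E : PublicEconomy N Y B) : Prop where
  endow_nonneg : ∀ i, 0 ≤ E.endow i
  cost_nonneg : ∀ y, 0 ≤ E.cost y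
  total_pos : E.StrictlyPositive E.total
  total_sub_cost_pos : ∀ y, E.StrictlyPositive (E.total - E.cost y)
  desirable : E.Desirable

/-- `(x, y)` is a feasible allocation. -/
def IsFeasible (E : PublicEconomy N Y B) (x : N → B) (y : Y) : Prop :=
  (∀ i, 0 ≤ x i) ∧ ∑ i, x i + E.cost y = ∑ i, E.endow i

/-- The essentiality condition. -/
def Essential (E : PublicEconomy N Y B) : Prop :=
  (∀ x : N → B, (∀ i, 0 ≤ x i) → ∀ y z i, ∃ ξ : B, 0 ≤ ξ ∧ E.util i (x i) y ≤ E.util i ξ z) ∧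
  ∀ i, ∀ ξ : B, 0 ≤ ξ → ∀ y z, E.util i 0 z ≤ E.util i ξ y

/-- The set `P_i^z(x_i, y)` of private bundles that, together with the project `z`, agent `i`
strictly prefers to `(xi, y)`. -/
def preferred (E : PublicEconomy N Y B) (i : N) (xi : B) (y z : Y) : Set B :=
  {ξ | 0 ≤ ξ ∧ E.util i xi y < E.util i ξ z}

/-- Integrable utilities. -/
def IntegrableUtilities (E : PublicEconomy N Y B) : Prop :=
  ∀ x y, E.IsFeasible x y → ∀ z, (∀ i, (E.preferred i (x i) y z).Nonempty) →
    ∃ ξ, E.IsFeasible ξ z ∧ ∀ i, E.util i (x i) y ≤ E.util i (ξ i) z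

/-- `(x, y)` is `z`-dominated by the grand coalition in the economy `E`. -/
def ZDominated (E : PublicEconomy N Y B) (x : N → B) (y z : Y) : Prop :=
  ∃ ξ, E.IsFeasible ξ z ∧ ∀ i, E.util i (x i) y < E.util i (ξ i) z

/-- Pareto optimal allocations. -/
def ParetoOptimal (E : PublicEconomy N Y B) (x : N → B) (y : Y) : Prop :=
  E.IsFeasible x y ∧ ∀ z, ¬ E.ZDominated x y z

/-- ATY-properness of the preference relation of agent `i` at `(xi, y)`. -/
def ATYProper (E : PublicEconomy N Y B) (i : N) (xi : B) (y : Y) : Prop :=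
  ∀ z, ∃ Q : Set B, Convex ℝ Q ∧ (interior Q).Nonempty ∧
    Q ∩ Set.Ici 0 = E.preferred i xi y z ∧ (interior Q ∩ Set.Ici 0).Nonempty

/-- Strong ATY-properness of the preference relation of agent `i` at `(xi, y)`. -/
def StronglyATYProper (E : PublicEconomy N Y B) (i : N) (xi : B) (y : Y) : Prop :=
  ∀ z, ∃ Q : Set B, Convex ℝ Q ∧ (interior Q).Nonempty ∧
    Q ∩ Set.Ici 0 = E.preferred i xi y z ∧
    (interior Q ∩ Set.Ici 0 ∩ principalIdeal E.total).Nonempty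

/-- The properness condition. -/
def Properness (E : PublicEconomy N Y B) : Prop :=
  ∀ x y, E.ParetoOptimal x y → ∀ i, E.ATYProper i (x i) y

/-- The strong properness condition. -/
def StrongProperness (E : PublicEconomy N Y B) : Prop :=
  ∀ x y, E.ParetoOptimal x y → ∀ i, E.StronglyATYProper i (x i) y

/-- The three alternative standing conditions on the positive cone and on properness. -/
def ConeRegime (E : PublicEconomy N Y B) : Prop :=
  (interior (Set.Ici (0 : B))).Nonempty ∨
  (interior (Set.Ici (0 : B)) = ∅ ∧ (∃ v : B, IsQuasiInteriorPoint v) ∧ E.Properness) ∨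
  ((¬ ∃ v : B, IsQuasiInteriorPoint v) ∧ E.StrongProperness)

/-- The budget set of agent `i` at prices `π` and cost shares `ρ`. -/
def budget (E : PublicEconomy N Y B) (ρ : N → Y → ℝ) (π : Y → (B →L[ℝ] ℝ)) (i : N) :
    Set (B × Y) :=
  {p | 0 ≤ p.1 ∧ π p.2 p.1 + ρ i p.2 * π p.2 (E.cost p.2) ≤ π p.2 (E.endow i)}

/-- `(x, y)` is a cost share equilibrium with cost distribution function `ρ`. -/
def IsCostShareEquilibrium (E : PublicEconomy N Y B) (ρ : N → Y → ℝ) (x : N → B) (y : Y) :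
    Prop :=
  E.IsFeasible x y ∧ IsCostDistribution ρ ∧
  ∃ π : Y → (B →L[ℝ] ℝ), (∀ z, ∀ b : B, 0 ≤ b → 0 ≤ π z b) ∧
    ∀ i, (x i, y) ∈ E.budget ρ π i ∧
      ∀ p ∈ E.budget ρ π i, E.util i p.1 p.2 ≤ E.util i (x i) y

/-- `(x, y)` is `σ`-blocked by the coalition `S`. -/
def IsBlockedBy (E : PublicEconomy N Y B) (σ : Finset N → Y → ℝ) (x : N → B) (y : Y)
    (S : Finset N) : Prop :=
  ∃ (z : Y) (ξ : N → B), (∀ i, 0 ≤ ξ i) ∧ (∀ i ∈ S, E.util i (x i) y < E.util i (ξ i) z) ∧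
    ∑ i ∈ S, ξ i + σ S z • E.cost z = ∑ i ∈ S, E.endow i

/-- The `σ`-core. -/
def InCore (E : PublicEconomy N Y B) (σ : Finset N → Y → ℝ) (x : N → B) (y : Y) : Prop :=
  E.IsFeasible x y ∧ ∀ S : Finset N, S.Nonempty → ¬ E.IsBlockedBy σ x y S

/-- Aubin (generalized) coalitions: participation rates in `[0,1]`, not all zero. -/
def IsAubinCoalition (γ : N → ℝ) : Prop :=
  (∀ i, γ i ∈ Set.Icc (0 : ℝ) 1) ∧ ∃ i, 0 < γ i

/-- The contribution of an Aubin coalition to the cost of a project. -/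
def aubinContribution (σ : Finset N → Y → ℝ) (γ : N → ℝ) (z : Y) : ℝ :=
  ∑ i, γ i * σ {i} z

/-- `(x, y)` is `σ`-blocked by the Aubin coalition `γ`. -/
def IsAubinBlockedBy (E : PublicEconomy N Y B) (σ : Finset N → Y → ℝ) (x : N → B) (y : Y)
    (γ : N → ℝ) : Prop :=
  ∃ (z : Y) (ξ : N → B), (∀ i, 0 ≤ ξ i) ∧
    (∀ i, 0 < γ i → E.util i (x i) y < E.util i (ξ i) z) ∧
    ∑ i, γ i • ξ i + aubinContribution σ γ z • E.cost z = ∑ i, γ i • E.endow i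

/-- The `σ`-Aubin core. -/
def InAubinCore (E : PublicEconomy N Y B) (σ : Finset N → Y → ℝ) (x : N → B) (y : Y) : Prop :=
  E.IsFeasible x y ∧ ∀ γ : N → ℝ, IsAubinCoalition γ → ¬ E.IsAubinBlockedBy σ x y γ

/-- Aubin non-dominated allocations: those not blocked by an Aubin coalition in which every
agent participates with a non-zero rate. -/
def AubinNonDominated (E : PublicEconomy N Y B) (σ : Finset N → Y → ℝ) (x : N → B) (y : Y) :
    Prop :=
  E.IsFeasible x y ∧
    ∀ γ : N → ℝ, IsAubinCoalition γ → (∀ i, 0 < γ i) → ¬ E.IsAubinBlockedBy σ x y γ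

/-- The `r`-fold replica economy, in which agent `(i, j)` is the `j`-th agent of type `i`. -/
def replica (E : PublicEconomy N Y B) (r : ℕ) : PublicEconomy (N × Fin r) Y B where
  endow p := E.endow p.1
  cost y := (r : ℝ) • E.cost y
  util p := E.util p.1

/-- The contribution measure of the `r`-fold replica economy: agent `(i, j)` contributes the
fraction `σ {i} / r`. -/
noncomputable def replicaContribution (σ : Finset N → Y → ℝ) (r : ℕ) (S : Finset (N × Fin r)) (y : Y) : ℝ :=
  ∑ p ∈ S, σ {p.1} y / r

/-- `σ`-Edgeworth equilibria. -/
def IsEdgeworthEquilibrium (E : PublicEconomy N Y B) (σ : Finset N → Y → ℝ) (x : N → B) (y : Y) :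
    Prop :=
  E.IsFeasible x y ∧
    ∀ r : ℕ, 0 < r → (E.replica r).InCore (replicaContribution σ r) (fun p => x p.1) y

/-- The economy which differs from `E` only in the endowments, which are
`α_i e_i + (1 - α_i) (ξ_i + ρ(i,z) c(z))`. -/
def perturbed (E : PublicEconomy N Y B) (ρ : N → Y → ℝ) (ξ : N → B) (z : Y) (α : N → ℝ) :
    PublicEconomy N Y B where
  endow i := α i • E.endow i + (1 - α i) • (ξ i + ρ i z • E.cost z)
  cost := E.cost
  util := E.util

end Order

end PublicEconomy

/-! Fix a project `z` and put `a i = e_i - σ({i},z) c(z)`. Every balance equation then becomes a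
weighted sum of net trades equal to zero (`aubin_balance_iff`, `replica_balance_iff`,
`perturbed_balance_iff`). So for each `z` there is an exchange economy with endowments `a i` and
preferred sets `P_i^z`, in which `γ^z` is a redistribution of `∑ a i`.

All implications except (iii) ⇒ (i) are elementary. Equilibrium prices value every preferred net
trade positively, so no Aubin coalition balances. Edgeworth and Aubin blocking are exchanged by
averaging within types and by rounding participation rates up. Aubin domination and the perturbed
economies are exchanged by mixing bundles with `γ^z`.

For (iii) ⇒ (i), the net trades in the ideal `L` of `∑ a i` form a convex cone containing no
nonpositive multiple of `∑ a i`. The Riesz extension theorem gives a linear `f` supporting the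
preferred sets inside `L` (`exists_supporting_linearMap`). Properness replaces `f`, agent by agent,
by continuous `p i` below `f` on the positive cone of `L` that still support agent `i`
(`exists_continuous_minorant`). Since `f` and `p i` agree at `γ^z_i`, Riesz decomposition along `∑
γ^z_i` makes `f` norm bounded on `L`. A second separation extends `f` to a continuous `π` dominating
every `p i` on the whole cone (`exists_extension_dominating`), and `π` supports all preferred
bundles. Since `a i ≫ 0`, `π (a i) > 0`, and scaling down makes the support inequality strict. -/

set_option linter.unusedSectionVars false

/-! ### The principal ideal and Riesz decompositions -/

section Ideal

variable {B : Type*} [AddCommGroup B] [Lattice B] [Module ℝ B]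

theorem abs_smul_le_abs_smul_abs [IsOrderedModule ℝ B] (t : ℝ) (v : B) :
    |t • v| ≤ |t| • |v| := by
  have key : ∀ s : ℝ, 0 ≤ s → |s • v| ≤ s • |v| := fun s hs =>
    sup_le (smul_le_smul_of_nonneg_left (le_abs_self v) hs) (by
      rw [← smul_neg]
      exact smul_le_smul_of_nonneg_left (neg_le_abs v) hs)
  rcases le_total 0 t with ht | ht
  · rw [abs_of_nonneg ht]
    exact key t ht
  · rw [abs_of_nonpos ht, ← abs_neg, ← neg_smul]
    exact key (-t) (neg_nonneg.2 ht)

variable [IsOrderedAddMonoid B]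

theorem exists_nonneg_of_mem_principalIdeal [IsOrderedModule ℝ B] {w v : B} (h : v ∈ principalIdeal w) :
    ∃ r : ℝ, 0 ≤ r ∧ |v| ≤ r • |w| := by
  obtain ⟨r, hr⟩ := h
  refine ⟨|r|, abs_nonneg r, hr.trans ?_⟩
  exact smul_le_smul_of_nonneg_right (le_abs_self r) (abs_nonneg w)

/-- The principal ideal as a linear subspace. -/
def principalSubmodule [IsOrderedModule ℝ B] (w : B) : Submodule ℝ B where
  carrier := principalIdeal w
  zero_mem' := ⟨0, by simp⟩
  add_mem' := by
    rintro u v ⟨r, hr⟩ ⟨s, hs⟩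
    exact ⟨r + s, (abs_add_le u v).trans (by rw [add_smul]; exact add_le_add hr hs)⟩
  smul_mem' := by
    rintro t v ⟨r, hr⟩
    refine ⟨|t| * r, ?_⟩
    rw [mul_smul]
    exact (abs_smul_le_abs_smul_abs t v).trans (smul_le_smul_of_nonneg_left hr (abs_nonneg t))

variable [IsOrderedModule ℝ B]

theorem principalSubmodule_of_abs_le {w v u : B} (hv : v ∈ principalSubmodule w)
    (h : |u| ≤ |v|) : u ∈ principalSubmodule w := by
  obtain ⟨r, hr⟩ := hv
  exact ⟨r, h.trans hr⟩

theorem self_mem_principalSubmodule (w : B) : w ∈ principalSubmodule w := ⟨1, by simp⟩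

theorem principalSubmodule_of_le {w v u : B} (hv : v ∈ principalSubmodule w)
    (h0 : 0 ≤ u) (h : u ≤ v) : u ∈ principalSubmodule w :=
  principalSubmodule_of_abs_le hv (by rwa [abs_of_nonneg h0, abs_of_nonneg (h0.trans h)])

theorem abs_mem_principalSubmodule {w v : B} (hv : v ∈ principalSubmodule w) :
    |v| ∈ principalSubmodule w :=
  principalSubmodule_of_abs_le hv (by simp)

end Ideal

section Riesz

variable {B : Type*} [AddCommGroup B] [Lattice B] [IsOrderedAddMonoid B]

theorem sub_inf_le_of_le_add {v b c : B} (hc : 0 ≤ c) (h : v ≤ b + c) : v - v ⊓ b ≤ c := by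
  rw [sub_le_iff_le_add', inf_add]
  exact le_inf (le_add_of_nonneg_right hc) h

/-- The Riesz decomposition property for finite sums. -/
theorem exists_riesz_decomposition {ι : Type*} (s : Finset ι) (b : ι → B)
    (hb : ∀ i, 0 ≤ b i) (v : B) (hv : 0 ≤ v) (hvb : v ≤ ∑ i ∈ s, b i) :
    ∃ w : ι → B, (∀ i, 0 ≤ w i ∧ w i ≤ b i) ∧ ∑ i ∈ s, w i = v := by
  classical
  induction s using Finset.induction_on generalizing v with
  | empty => exact ⟨0, fun i => ⟨le_rfl, hb i⟩, by simpa using hv.antisymm (by simpa using hvb)⟩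
  | insert j s hj ih =>
    rw [Finset.sum_insert hj] at hvb
    obtain ⟨w, hw, hws⟩ := ih (v - v ⊓ b j) (sub_nonneg.2 inf_le_left)
      (sub_inf_le_of_le_add (Finset.sum_nonneg fun i _ => hb i) hvb)
    refine ⟨Function.update w j (v ⊓ b j), fun i => ?_, ?_⟩
    · rcases eq_or_ne i j with rfl | hij
      · simpa using ⟨hv, hb _⟩
      · simpa [hij] using hw i
    · rw [Finset.sum_insert hj, Finset.sum_update_of_notMem hj, hws]
      simp

end Riesz

/-! ### Separation arguments -/

/-- An algebraic separation: a cone that contains no nonpositive multiple of `a`, and of which `a`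
is an internal direction, is supported by a linear functional normalized at `a`. -/
theorem exists_linearMap_nonneg_on_cone {V : Type*} [AddCommGroup V] [Module ℝ V] (a : V)
    (S : Set V) (hadd : ∀ u ∈ S, ∀ v ∈ S, u + v ∈ S)
    (hsmul : ∀ t : ℝ, 0 < t → ∀ v ∈ S, t • v ∈ S) (ha : a ≠ 0)
    (hneg : ∀ t : ℝ, t ≤ 0 → t • a ∉ S) (hdense : ∀ v, ∃ t : ℝ, t • a + v ∈ S) :
    ∃ f : V →ₗ[ℝ] ℝ, f a = 1 ∧ ∀ v ∈ S, 0 ≤ f v := by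
  let C : PointedCone ℝ V :=
    { carrier := {v | v = 0 ∨ v ∈ S}
      zero_mem' := Or.inl rfl
      add_mem' := by
        rintro u v (rfl | hu) (rfl | hv)
        · left; simp
        · right; simpa using hv
        · right; simpa using hu
        · exact Or.inr (hadd u hu v hv)
      smul_mem' := by
        rintro ⟨t, ht⟩ v (rfl | hv)
        · left; simp
        · rcases ht.eq_or_lt with rfl | ht'
          · left
            exact zero_smul ℝ v
          · exact Or.inr (hsmul t ht' v hv) }
  have hC : ∀ v, v ∈ C ↔ v = 0 ∨ v ∈ S := fun v => Iff.rfl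
  obtain ⟨g, hg, hgC⟩ := riesz_extension C (LinearPMap.mkSpanSingleton a (1 : ℝ) ha)
    (by
      rintro ⟨v, hv⟩ hvC
      obtain ⟨t, rfl⟩ := Submodule.mem_span_singleton.1 hv
      have h1 := LinearPMap.mkSpanSingleton'_apply (R := ℝ) a (1 : ℝ)
        (fun c hc => by
          rw [(smul_eq_zero.1 hc).resolve_right ha, map_zero, zero_smul]) t hv
      refine le_of_le_of_eq ?_ h1.symm
      rw [smul_eq_mul, mul_one, RingHom.id_apply]
      rcases (hC _).1 hvC with h | h
      · exact ((smul_eq_zero.1 h).resolve_right ha).ge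
      · by_contra! hlt
        exact hneg t hlt.le h)
    (fun v => by
      obtain ⟨t, ht⟩ := hdense v
      exact ⟨⟨t • a, Submodule.mem_span_singleton.2 ⟨t, rfl⟩⟩, Or.inr ht⟩)
  refine ⟨g, ?_, fun v hv => hgC v (Or.inr hv)⟩
  have h := hg ⟨a, Submodule.mem_span_singleton_self a⟩
  rw [h]
  exact LinearPMap.mkSpanSingleton_apply ℝ ℝ ha (1 : ℝ)

/-- Podczeck's lemma: a linear functional `f` that is bounded below by `α` on the intersection of
an open convex set `Q` with a cone `K` can be replaced by a continuous functional that is below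
`f` on `K` and still bounded below by `α` on `Q`. -/
theorem exists_continuous_minorant {B : Type*} [NormedAddCommGroup B] [NormedSpace ℝ B]
    (f : B →ₗ[ℝ] ℝ) (K : Set B) (hK0 : (0 : B) ∈ K) (hKadd : ∀ u ∈ K, ∀ v ∈ K, u + v ∈ K)
    (hKsmul : ∀ t : ℝ, 0 ≤ t → ∀ v ∈ K, t • v ∈ K) (Q : Set B) (hQ : Convex ℝ Q)
    (hQo : IsOpen Q) (hQK : (Q ∩ K).Nonempty) (α : ℝ) (hα : ∀ v ∈ Q ∩ K, α ≤ f v) :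
    ∃ p : B →L[ℝ] ℝ, (∀ v ∈ K, p v ≤ f v) ∧ ∀ v ∈ Q, α ≤ p v := by
  -- Separate `Q × (-∞, α)` from the epigraph of `f` over `K`; the graph of the desired `p` is the
  -- homogeneous part of the separating hyperplane.
  obtain ⟨φ, c, hφ₁, hφ₂⟩ := geometric_hahn_banach_open (E := B × ℝ) (s := Q ×ˢ Set.Iio α)
    (t := {x | x.1 ∈ K ∧ f x.1 ≤ x.2}) (hQ.prod (convex_Iio α)) (hQo.prod isOpen_Iio)
    (by
      rintro ⟨u, s⟩ ⟨hu, hs⟩ ⟨v, t⟩ ⟨hv, ht⟩ r q hr hq _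
      refine ⟨hKadd _ (hKsmul r hr u hu) _ (hKsmul q hq v hv), ?_⟩
      simp only [Prod.smul_mk, Prod.mk_add_mk, map_add, map_smul]
      exact add_le_add (smul_le_smul_of_nonneg_left hs hr) (smul_le_smul_of_nonneg_left ht hq))
    (by
      rw [Set.disjoint_left]
      rintro ⟨v, s⟩ ⟨hv, hs⟩ ⟨hvK, hvs⟩
      have := hα v ⟨hv, hvK⟩
      simp only [Set.mem_Iio] at hs hvs
      linarith)
  set g : B →L[ℝ] ℝ := φ.comp (ContinuousLinearMap.inl ℝ B ℝ) with hg
  set l : ℝ := φ (0, 1) with hl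
  have hφ : ∀ v s, φ (v, s) = g v + s * l := by
    intro v s
    have : ((v, s) : B × ℝ) = (v, 0) + s • (0, 1) := by simp
    rw [this, map_add, map_smul]
    simp [hg, hl]
  have hc : c ≤ 0 := by
    have := hφ₂ (0, 0) ⟨hK0, by simp⟩
    simpa [hφ] using this
  have hcone : ∀ v ∈ K, 0 ≤ g v + f v * l := by
    intro v hv
    by_contra! hlt
    -- The multiple is chosen so that `φ` takes the value `c - 1 < c` on the cone.
    have h1 := hφ₂ (((c - 1) / (g v + f v * l)) • v, ((c - 1) / (g v + f v * l)) * f v)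
      ⟨hKsmul _ (div_nonneg_of_nonpos (by linarith) hlt.le) v hv, by simp⟩
    rw [hφ, map_smul, smul_eq_mul] at h1
    have h2 : (c - 1) / (g v + f v * l) * g v + (c - 1) / (g v + f v * l) * f v * l = c - 1 := by
      have := hlt.ne
      field_simp
    linarith
  obtain ⟨q, hqQ, hqK⟩ := hQK
  have hq := hα q ⟨hqQ, hqK⟩
  have hq1 := hφ₁ (q, α - 1) ⟨hqQ, by simp⟩
  rw [hφ] at hq1
  have hq2 := hcone q hqK
  -- The hyperplane is not vertical because `Q` meets `K`: over `q` both separated sets have points.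
  have hlpos : 0 < l := by
    by_contra! hle
    nlinarith [mul_nonneg_of_nonpos_of_nonpos (sub_nonpos.2 (by linarith : α - 1 ≤ f q)) hle]
  refine ⟨-(l⁻¹ • g), fun v hv => ?_, fun v hv => ?_⟩
  · have := hcone v hv
    simp only [neg_apply, smul_apply, smul_eq_mul]
    rw [neg_le_iff_add_nonneg]
    have h3 : f v + l⁻¹ * g v = l⁻¹ * (g v + f v * l) := by field_simp; ring
    rw [h3]
    positivity
  · simp only [neg_apply, smul_apply, smul_eq_mul]
    refine le_of_forall_lt fun s hs => ?_
    have := hφ₁ (v, s) ⟨hv, hs⟩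
    rw [hφ] at this
    have h3 : -(l⁻¹ * g v) - s = l⁻¹ * -(g v + s * l) := by field_simp; ring
    have h4 : 0 < -(l⁻¹ * g v) - s := by
      rw [h3]
      exact mul_pos (inv_pos.2 hlpos) (by linarith)
    linarith

/-- Stands in for letting `ε → 0` in the perturbation and scaling arguments below. -/
theorem nonneg_of_forall_pos_nonneg_add_mul {A D : ℝ} (h : ∀ ε : ℝ, 0 < ε → 0 ≤ A + ε * D) :
    0 ≤ A := by
  refine le_of_forall_pos_le_add fun δ hδ => ?_
  have hD : 0 < |D| + 1 := by positivity
  have h1 := h (δ / (|D| + 1)) (div_pos hδ hD)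
  have h2 : δ / (|D| + 1) * D ≤ δ := by
    rw [div_mul_eq_mul_div, div_le_iff₀ hD]
    nlinarith [le_abs_self D]
  linarith

/-! ### Supporting functionals on the ideal and their continuous extension -/

section Support

variable {N B : Type*} [Fintype N] [NormedAddCommGroup B] [Lattice B] [IsOrderedAddMonoid B]
  [HasSolidNorm B] [NormedSpace ℝ B] [IsOrderedModule ℝ B]

/-- A family of continuous functionals that lie below a norm-bounded functional `f` on the positive
cone of an ideal admits a common continuous majorant on the whole positive cone that agrees
with `f` on the ideal. -/
theorem exists_extension_dominating (w : B) (f : B →ₗ[ℝ] ℝ) (M : ℝ) (hM : 0 ≤ M)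
    (hf : ∀ v ∈ principalSubmodule w, |f v| ≤ M * ‖v‖) (p : N → B →L[ℝ] ℝ)
    (hp : ∀ i, ∀ v ∈ principalSubmodule w, 0 ≤ v → p i v ≤ f v) :
    ∃ π : B →L[ℝ] ℝ, (∀ v ∈ principalSubmodule w, π v = f v) ∧
      ∀ i b, 0 ≤ b → p i b ≤ π b := by
  classical
  -- `2 * M` pays for replacing `v` by `s ⊓ |v|`, and `∑ i, ‖p i‖` for the parts of the `b i` left
  -- outside the ideal.
  set K : ℝ := 2 * M + ∑ i, ‖p i‖ with hK
  have hK0 : 0 ≤ K := by positivity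
  have claim : ∀ b : N → B, (∀ i, 0 ≤ b i) → ∀ v ∈ principalSubmodule w,
      ∑ i, p i (b i) ≤ f v + K * ‖∑ i, b i - v‖ := by
    intro b hb v hv
    set s := ∑ i, b i with hs
    have hs0 : 0 ≤ s := Finset.sum_nonneg fun i _ => hb i
    set d := s - v with hd
    have hV0 : 0 ≤ s ⊓ |v| := le_inf hs0 (abs_nonneg v)
    obtain ⟨u, hu, hus⟩ := exists_riesz_decomposition Finset.univ b hb (s ⊓ |v|) hV0 inf_le_left
    have hVL : s ⊓ |v| ∈ principalSubmodule w :=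
      principalSubmodule_of_le (abs_mem_principalSubmodule hv) hV0 inf_le_right
    have huL : ∀ i, u i ∈ principalSubmodule w := fun i =>
      principalSubmodule_of_le hVL (hu i).1
        (hus ▸ Finset.single_le_sum (f := u) (fun j _ => (hu j).1) (Finset.mem_univ i))
    have hW0 : 0 ≤ s - s ⊓ |v| := sub_nonneg.2 inf_le_left
    have hWd : s - s ⊓ |v| ≤ |d| := by
      refine sub_inf_le_of_le_add (abs_nonneg d) ?_
      calc s = v + d := by rw [hd]; abel
        _ ≤ |v| + |d| := add_le_add (le_abs_self v) (le_abs_self d)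
    have hWn : ‖s - s ⊓ |v|‖ ≤ ‖d‖ :=
      norm_le_norm_of_abs_le_abs (by rwa [abs_of_nonneg hW0])
    have hrest : ∀ i, ‖b i - u i‖ ≤ ‖d‖ := by
      intro i
      have h0 : ∀ j, 0 ≤ b j - u j := fun j => sub_nonneg.2 (hu j).2
      refine le_trans (norm_le_norm_of_abs_le_abs ?_) hWn
      rw [abs_of_nonneg (h0 i), abs_of_nonneg hW0]
      calc b i - u i ≤ ∑ j, (b j - u j) :=
            Finset.single_le_sum (f := fun j => b j - u j) (fun j _ => h0 j) (Finset.mem_univ i)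
        _ = s - s ⊓ |v| := by rw [Finset.sum_sub_distrib, hus]
    have h1 : ∀ i, p i (b i) ≤ f (u i) + ‖p i‖ * ‖d‖ := by
      intro i
      have e : b i = u i + (b i - u i) := by abel
      rw [e, map_add]
      refine add_le_add (hp i _ (huL i) (hu i).1) ?_
      exact (le_abs_self _).trans (((p i).le_opNorm _).trans
        (mul_le_mul_of_nonneg_left (hrest i) (norm_nonneg _)))
    have h2 : f (s ⊓ |v|) ≤ f v + 2 * M * ‖d‖ := by
      have h3 := (le_abs_self _).trans (hf (s ⊓ |v| - v) (Submodule.sub_mem _ hVL hv))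
      have h4 : ‖s ⊓ |v| - v‖ ≤ ‖d‖ + ‖d‖ := by
        have : s ⊓ |v| - v = d - (s - s ⊓ |v|) := by rw [hd]; abel
        rw [this]
        exact (norm_sub_le _ _).trans (by gcongr)
      rw [map_sub] at h3
      nlinarith [mul_le_mul_of_nonneg_left h4 hM]
    calc ∑ i, p i (b i) ≤ ∑ i, (f (u i) + ‖p i‖ * ‖d‖) := Finset.sum_le_sum fun i _ => h1 i
      _ = f (s ⊓ |v|) + (∑ i, ‖p i‖) * ‖d‖ := by
        rw [Finset.sum_add_distrib, ← map_sum, hus, Finset.sum_mul]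
      _ ≤ f v + K * ‖d‖ := by rw [hK]; nlinarith
  -- By `claim`, the supremum of `∑ p i (b i)` over decompositions of a point lies below the infimum
  -- of `f v + K * ‖· - v‖`. A hyperplane between the two gives `π`.
  obtain ⟨φ, c, hφ₁, hφ₂⟩ := geometric_hahn_banach_open (E := B × ℝ)
    (s := {x | ∃ v ∈ principalSubmodule w, f v + K * ‖x.1 - v‖ < x.2})
    (t := {x | ∃ b : N → B, (∀ i, 0 ≤ b i) ∧ ∑ i, b i = x.1 ∧ x.2 ≤ ∑ i, p i (b i)})
    (by
      rintro ⟨b₁, s₁⟩ ⟨v₁, hv₁, h₁⟩ ⟨b₂, s₂⟩ ⟨v₂, hv₂, h₂⟩ r q hr hq hrq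
      refine ⟨r • v₁ + q • v₂, Submodule.add_mem _ (Submodule.smul_mem _ _ hv₁)
        (Submodule.smul_mem _ _ hv₂), ?_⟩
      simp only [Prod.smul_mk, Prod.mk_add_mk, map_add, map_smul, smul_eq_mul] at h₁ h₂ ⊢
      have e : r • b₁ + q • b₂ - (r • v₁ + q • v₂) = r • (b₁ - v₁) + q • (b₂ - v₂) := by
        rw [smul_sub, smul_sub]; abel
      have h3 : ‖r • (b₁ - v₁) + q • (b₂ - v₂)‖ ≤ r * ‖b₁ - v₁‖ + q * ‖b₂ - v₂‖ := by
        refine (norm_add_le _ _).trans_eq ?_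
        rw [norm_smul, norm_smul, Real.norm_of_nonneg hr, Real.norm_of_nonneg hq]
      rw [e]
      have h4 := mul_le_mul_of_nonneg_left h3 hK0
      rcases hr.eq_or_lt with rfl | hr'
      · have : q = 1 := by linarith
        subst this
        linarith
      · have h5 := mul_lt_mul_of_pos_left h₁ hr'
        have h6 := mul_le_mul_of_nonneg_left h₂.le hq
        linarith)
    (by
      have : {x : B × ℝ | ∃ v ∈ principalSubmodule w, f v + K * ‖x.1 - v‖ < x.2} =
          ⋃ v ∈ principalSubmodule w, {x : B × ℝ | f v + K * ‖x.1 - v‖ < x.2} := by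
        ext x; simp
      rw [this]
      exact isOpen_biUnion fun v _ => isOpen_lt (by fun_prop) (by fun_prop))
    (by
      rintro ⟨b₁, s₁⟩ ⟨v₁, hv₁, h₁, h₁'⟩ ⟨b₂, s₂⟩ ⟨v₂, hv₂, h₂, h₂'⟩ r q hr hq _
      refine ⟨fun i => r • v₁ i + q • v₂ i, fun i => add_nonneg (smul_nonneg hr (hv₁ i))
        (smul_nonneg hq (hv₂ i)), ?_, ?_⟩
      · simp only at h₁ h₂
        simp [Finset.sum_add_distrib, ← Finset.smul_sum, h₁, h₂]
      · simp only [Prod.smul_mk, Prod.mk_add_mk, map_add, map_smul, smul_eq_mul,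
          Finset.sum_add_distrib, ← Finset.mul_sum] at h₁' h₂' ⊢
        exact add_le_add (mul_le_mul_of_nonneg_left h₁' hr) (mul_le_mul_of_nonneg_left h₂' hq))
    (by
      rw [Set.disjoint_left]
      rintro ⟨b, s⟩ ⟨v, hv, hvs⟩ ⟨u, hu, hub, hus⟩
      have := claim u hu v hv
      simp only at hub hus hvs
      rw [hub] at this
      linarith)
  set g : B →L[ℝ] ℝ := φ.comp (ContinuousLinearMap.inl ℝ B ℝ) with hg
  set l : ℝ := φ (0, 1) with hl
  have hφ : ∀ v s, φ (v, s) = g v + s * l := by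
    intro v s
    have : ((v, s) : B × ℝ) = (v, 0) + s • (0, 1) := by simp
    rw [this, map_add, map_smul]
    simp [hg, hl]
  have hc : c ≤ 0 := by
    have := hφ₂ (0, 0) ⟨fun _ => 0, fun _ => le_rfl, by simp, by simp⟩
    simpa [hφ] using this
  have hlneg : l < 0 := by
    have := hφ₁ (0, 1) ⟨0, Submodule.zero_mem _, by simp⟩
    rw [hφ] at this
    simp only [map_zero] at this
    linarith
  have hcone : ∀ i b, 0 ≤ b → 0 ≤ g b + p i b * l := by
    intro i b hb
    refine nonneg_of_forall_pos_nonneg_add_mul (D := -c) fun ε hε => ?_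
    have h1 := hφ₂ (ε⁻¹ • b, ε⁻¹ * p i b) ⟨Pi.single i (ε⁻¹ • b), fun j => ?_, by simp, ?_⟩
    · rw [hφ, map_smul, smul_eq_mul] at h1
      have h2 := mul_le_mul_of_nonneg_left h1 hε.le
      have h3 : ε * (ε⁻¹ * g b + ε⁻¹ * p i b * l) = g b + p i b * l := by
        field_simp
      linarith
    · rcases eq_or_ne j i with rfl | hj
      · simpa using smul_nonneg (inv_nonneg.2 hε.le) hb
      · simp [hj]
    · have : ∀ j, p j (Pi.single (M := fun _ => B) i (ε⁻¹ • b) j) =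
          Pi.single (M := fun _ => ℝ) i (ε⁻¹ * p i b) j := by
        intro j
        rcases eq_or_ne j i with rfl | hj
        · simp
        · simp [hj]
      simp [this]
  have hle : ∀ v ∈ principalSubmodule w, (-l)⁻¹ * g v ≤ f v := by
    intro v hv
    rw [inv_mul_le_iff₀ (neg_pos.2 hlneg)]
    refine sub_nonneg.1 (nonneg_of_forall_pos_nonneg_add_mul (D := -l) fun ε hε => ?_)
    have := hφ₁ (v, f v + ε) ⟨v, hv, by simpa using hε⟩
    rw [hφ] at this
    linarith
  refine ⟨(-l)⁻¹ • g, fun v hv => ?_, fun i b hb => ?_⟩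
  -- On a subspace, the inequality at `v` and at `-v` is an equality.
  · have h1 := hle v hv
    have h2 := hle (-v) (Submodule.neg_mem _ hv)
    rw [map_neg, map_neg] at h2
    simp only [smul_apply, smul_eq_mul]
    linarith
  · simp only [smul_apply, smul_eq_mul]
    rw [le_inv_mul_iff₀ (neg_pos.2 hlneg)]
    linarith [hcone i b hb]

variable [Nonempty N]

/-- An exchange economy without dominating generalized coalitions has a supporting linear
functional on the ideal generated by the total endowment. -/
theorem exists_supporting_linearMap (a : N → B) (ha : ∀ i, 0 ≤ a i) (ha0 : ∑ i, a i ≠ 0)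
    (P : N → Set B) (hP : ∀ i, Convex ℝ (P i)) (hPup : ∀ i, ∀ ξ ∈ P i, ∀ b, 0 ≤ b → ξ + b ∈ P i)
    (hPne : ∀ i, ∃ ξ ∈ P i, ξ ∈ principalSubmodule (∑ i, a i))
    (hnd : ∀ β : N → ℝ, (∀ i, 0 < β i) → ∀ ξ : N → B, (∀ i, ξ i ∈ P i) →
      ∑ i, β i • (ξ i - a i) ≠ 0) :
    ∃ f : B →ₗ[ℝ] ℝ, f (∑ i, a i) = 1 ∧
      ∀ i, ∀ ξ ∈ P i, ξ ∈ principalSubmodule (∑ i, a i) → f (a i) ≤ f ξ := by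
  classical
  set e := ∑ i, a i with he
  set L := principalSubmodule e with hL
  have he0 : 0 ≤ e := Finset.sum_nonneg fun i _ => ha i
  have heL : e ∈ L := self_mem_principalSubmodule e
  have haL : ∀ i, a i ∈ L := fun i => principalSubmodule_of_le heL (ha i)
    (Finset.single_le_sum (f := a) (fun j _ => ha j) (Finset.mem_univ i))
  choose h hhP hhL using hPne
  obtain ⟨f, hfe, hf⟩ := exists_linearMap_nonneg_on_cone (V := L) ⟨e, heL⟩
    {v | ∃ (β : N → ℝ) (ξ : N → B), (∀ i, 0 < β i) ∧ (∀ i, ξ i ∈ P i) ∧ (∀ i, ξ i ∈ L) ∧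
      (v : B) = ∑ i, β i • (ξ i - a i)}
    (by
      rintro u ⟨β, ξ, hβ, hξ, hξL, hu⟩ v ⟨β', ξ', hβ', hξ', hξL', hv⟩
      -- Adding net trades adds rates and averages bundles with the corresponding weights, so
      -- convexity suffices.
      refine ⟨fun i => β i + β' i, fun i => (β i / (β i + β' i)) • ξ i +
        (β' i / (β i + β' i)) • ξ' i, fun i => add_pos (hβ i) (hβ' i), fun i => ?_,
        fun i => ?_, ?_⟩
      · have := add_pos (hβ i) (hβ' i)
        refine hP i (hξ i) (hξ' i) (div_nonneg (hβ i).le this.le)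
          (div_nonneg (hβ' i).le this.le) ?_
        field_simp
      · exact L.add_mem (L.smul_mem _ (hξL i)) (L.smul_mem _ (hξL' i))
      · rw [Submodule.coe_add, hu, hv, ← Finset.sum_add_distrib]
        refine Finset.sum_congr rfl fun i _ => ?_
        have := (add_pos (hβ i) (hβ' i)).ne'
        match_scalars <;> field_simp
        ring)
    (by
      rintro t ht v ⟨β, ξ, hβ, hξ, hξL, hv⟩
      refine ⟨fun i => t * β i, ξ, fun i => mul_pos ht (hβ i), hξ, hξL, ?_⟩
      rw [Submodule.coe_smul, hv, Finset.smul_sum]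
      simp only [mul_smul])
    (fun h0 => ha0 (congrArg Subtype.val h0))
    (by
      rintro t ht ⟨β, ξ, hβ, hξ, hξL, hv⟩
      -- Giving back `-t • a i ≥ 0` to each agent turns the total `t • e` into zero.
      refine hnd β hβ (fun i => ξ i + (-t / β i) • a i) (fun i => hPup i _ (hξ i) _
        (smul_nonneg (div_nonneg (neg_nonneg.2 ht) (hβ i).le) (ha i))) ?_
      have h1 : ∀ i, β i • (ξ i + (-t / β i) • a i - a i) = β i • (ξ i - a i) - t • a i := by
        intro i
        have := (hβ i).ne'
        match_scalars <;> field_simp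
        ring
      simp only [h1]
      rw [Finset.sum_sub_distrib, ← hv, ← Finset.smul_sum, ← he]
      simp)
    (by
      rintro ⟨v, hv⟩
      have hsL : ∑ i, (h i - a i) ∈ L := L.sum_mem fun i _ => L.sub_mem (hhL i) (haL i)
      -- `e` is an order unit of `L`: for this `t` the surplus `d` is nonnegative and is shared
      -- equally.
      obtain ⟨t, ht⟩ := L.sub_mem hsL hv
      have ht' : 0 ≤ t • e + v - ∑ i, (h i - a i) := by
        rw [abs_of_nonneg he0] at ht
        have := (le_abs_self _).trans ht
        rw [← sub_nonneg] at this
        convert this using 1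
        abel
      set d := t • e + v - ∑ i, (h i - a i) with hd
      have hdL : d ∈ L := L.sub_mem (L.add_mem (L.smul_mem _ heL) hv) hsL
      refine ⟨t, fun _ => 1, fun i => h i + (Fintype.card N : ℝ)⁻¹ • d, fun _ => one_pos,
        fun i => hPup i _ (hhP i) _ (smul_nonneg (by positivity) ht'),
        fun i => L.add_mem (hhL i) (L.smul_mem _ hdL), ?_⟩
      have h1 : ∀ i, (1 : ℝ) • (h i + (Fintype.card N : ℝ)⁻¹ • d - a i) =
          (h i - a i) + (Fintype.card N : ℝ)⁻¹ • d := by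
        intro i
        rw [one_smul]; abel
      simp only [h1]
      rw [Finset.sum_add_distrib, Finset.sum_const, Finset.card_univ, ← Nat.cast_smul_eq_nsmul ℝ,
        smul_smul, mul_inv_cancel₀ (by positivity), one_smul, hd]
      simp)
  obtain ⟨F, hF⟩ := LinearMap.exists_extend f
  have hF' : ∀ v (hv : v ∈ L), F v = f ⟨v, hv⟩ := fun v hv => by
    rw [← hF]; rfl
  refine ⟨F, by rw [hF' e heL, hfe], fun i ξ hξ hξL => sub_nonneg.1 ?_⟩
  -- To isolate agent `i`, all other agents trade at rate `ε`.
  refine nonneg_of_forall_pos_nonneg_add_mul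
    (D := ∑ j ∈ Finset.univ.erase i, (F (h j) - F (a j))) fun ε hε => ?_
  have hmem : ξ - a i + ε • ∑ j ∈ Finset.univ.erase i, (h j - a j) ∈ L :=
    L.add_mem (L.sub_mem hξL (haL i))
      (L.smul_mem _ (L.sum_mem fun j _ => L.sub_mem (hhL j) (haL j)))
  have h1 := hf ⟨_, hmem⟩ ⟨fun j => if j = i then 1 else ε, Function.update h i ξ, fun j => ?_,
    fun j => ?_, fun j => ?_, ?_⟩
  · rw [← hF', map_add, map_sub, map_smul, map_sum, smul_eq_mul] at h1
    simpa only [map_sub] using h1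
  · dsimp only
    split_ifs
    exacts [one_pos, hε]
  · rcases eq_or_ne j i with rfl | hj
    · simpa using hξ
    · simpa [hj] using hhP j
  · rcases eq_or_ne j i with rfl | hj
    · simpa using hξL
    · simpa [hj] using hhL j
  · refine Eq.trans ?_ (Finset.add_sum_erase _ _ (Finset.mem_univ i))
    simp only [Finset.smul_sum]
    congr 1
    · simp
    · refine Finset.sum_congr rfl fun j hj => ?_
      simp [Finset.ne_of_mem_erase hj]

/-- In an exchange economy with endowments `a i` in which the preferred sets are proper and no
generalized coalition can improve, there is a positive continuous price functional that supports
the preferred sets and gives a positive value to every endowment. -/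
theorem exists_supporting_price (a : N → B) (ha : ∀ i, 0 ≤ a i) (ha0 : ∑ i, a i ≠ 0)
    (had : ∀ i, ∑ j, a j ∈ closure (principalIdeal (a i)))
    (Q : N → Set B) (hQ : ∀ i, Convex ℝ (Q i))
    (hQup : ∀ i, ∀ ξ ∈ Q i, 0 ≤ ξ → ∀ b, 0 ≤ b → ξ + b ∈ Q i)
    (hQint : ∀ i, ∃ ξ ∈ interior (Q i), 0 ≤ ξ ∧ ξ ∈ principalSubmodule (∑ i, a i))
    (g : N → B) (hg : ∀ i, 0 ≤ g i) (hgsum : ∑ i, g i = ∑ i, a i)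
    (hgQ : ∀ i, ∀ ε : ℝ, 0 < ε → g i + ε • ∑ i, a i ∈ Q i)
    (hnd : ∀ β : N → ℝ, (∀ i, 0 < β i) → ∀ ξ : N → B, (∀ i, ξ i ∈ Q i ∧ 0 ≤ ξ i) →
      ∑ i, β i • (ξ i - a i) ≠ 0) :
    ∃ π : B →L[ℝ] ℝ, (∀ b, 0 ≤ b → 0 ≤ π b) ∧ ∀ i, 0 < π (a i) ∧
      ∀ ξ ∈ Q i, 0 ≤ ξ → π (a i) ≤ π ξ := by
  classical
  obtain ⟨f, hfe, hf⟩ := exists_supporting_linearMap a ha ha0 (fun i => Q i ∩ Set.Ici 0)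
    (fun i => (hQ i).inter (convex_Ici 0))
    (fun i ξ hξ b hb => ⟨hQup i ξ hξ.1 hξ.2 b hb, add_nonneg hξ.2 hb⟩)
    (fun i => by
      obtain ⟨ξ, h1, h2, h3⟩ := hQint i
      exact ⟨ξ, ⟨interior_subset h1, h2⟩, h3⟩) hnd
  set e := ∑ i, a i with he
  set L := principalSubmodule e with hL
  have he0 : 0 ≤ e := Finset.sum_nonneg fun i _ => ha i
  have heL : e ∈ L := self_mem_principalSubmodule e
  have haL : ∀ i, a i ∈ L := fun i => principalSubmodule_of_le heL (ha i)
    (Finset.single_le_sum (f := a) (fun j _ => ha j) (Finset.mem_univ i))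
  have hgL : ∀ i, g i ∈ L := fun i => principalSubmodule_of_le heL (hg i)
    (hgsum ▸ Finset.single_le_sum (f := g) (fun j _ => hg j) (Finset.mem_univ i))
  choose h hhQ hh0 hhL using hQint
  have hfpos : ∀ v ∈ L, 0 ≤ v → 0 ≤ f v := by
    intro v hv hv0
    obtain ⟨i⟩ := ‹Nonempty N›
    refine nonneg_of_forall_pos_nonneg_add_mul (D := f (h i) - f (a i)) fun ε hε => ?_
    have hv' : 0 ≤ ε⁻¹ • v := smul_nonneg (inv_nonneg.2 hε.le) hv0
    have h1 := hf i (h i + ε⁻¹ • v) ⟨hQup i _ (interior_subset (hhQ i)) (hh0 i) _ hv',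
      add_nonneg (hh0 i) hv'⟩ (L.add_mem (hhL i) (L.smul_mem _ hv))
    rw [map_add, map_smul, smul_eq_mul] at h1
    have h2 := mul_le_mul_of_nonneg_left h1 hε.le
    have h3 : ε * (f (h i) + ε⁻¹ * f v) = ε * f (h i) + f v := by field_simp
    linarith
  -- Each `g i` is a limit of preferred bundles, which gives `≤`; equal totals force equality for
  -- every agent.
  have hfg : ∀ i, f (a i) = f (g i) := by
    have hle : ∀ i ∈ Finset.univ, f (a i) ≤ f (g i) := by
      intro i _
      refine sub_nonneg.1 (nonneg_of_forall_pos_nonneg_add_mul (D := f e) fun ε hε => ?_)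
      have := hf i (g i + ε • e) ⟨hgQ i ε hε, add_nonneg (hg i) (smul_nonneg hε.le he0)⟩
        (L.add_mem (hgL i) (L.smul_mem _ heL))
      rw [map_add, map_smul, smul_eq_mul] at this
      linarith
    have hsum : ∑ i, f (a i) = ∑ i, f (g i) := by rw [← map_sum, ← map_sum, hgsum]
    exact fun i => (Finset.sum_eq_sum_iff_of_le hle).1 hsum i (Finset.mem_univ i)
  have hp : ∀ i, ∃ p : B →L[ℝ] ℝ, (∀ v ∈ (L : Set B) ∩ Set.Ici 0, p v ≤ f v) ∧
      ∀ v ∈ interior (Q i), f (a i) ≤ p v := fun i =>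
    exists_continuous_minorant f ((L : Set B) ∩ Set.Ici 0) ⟨L.zero_mem, le_rfl⟩
      (fun u hu v hv => ⟨L.add_mem hu.1 hv.1, add_nonneg hu.2 hv.2⟩)
      (fun t ht v hv => ⟨L.smul_mem _ hv.1, smul_nonneg ht hv.2⟩)
      (interior (Q i)) (hQ i).interior isOpen_interior
      ⟨h i, hhQ i, hhL i, hh0 i⟩ _ (fun v hv => hf i v ⟨interior_subset hv.1, hv.2.2⟩ hv.2.1)
  choose p hpf hpQ using hp
  have hpQ' : ∀ i, ∀ v ∈ Q i, f (a i) ≤ p i v := by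
    intro i v hv
    have hcl : v ∈ closure (interior (Q i)) := by
      rw [(hQ i).closure_interior_eq_closure_of_nonempty_interior ⟨_, hhQ i⟩]
      exact subset_closure hv
    exact closure_minimal (hpQ i) (isClosed_le continuous_const (p i).continuous) hcl
  have hpg : ∀ i, f (g i) ≤ p i (g i) := by
    intro i
    rw [← hfg]
    refine sub_nonneg.1 (nonneg_of_forall_pos_nonneg_add_mul (D := p i e) fun ε hε => ?_)
    have := hpQ' i _ (hgQ i ε hε)
    rw [map_add, map_smul, smul_eq_mul] at this
    linarith
  -- Since `f - p i` is nonnegative on the cone of `L` and at most zero at `g i`, `f ≤ p i` on `[0,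
  -- r • g i]`. Decomposing `v` along these intervals yields the bound.
  have hbound : ∀ v ∈ L, 0 ≤ v → f v ≤ (∑ i, ‖p i‖) * ‖v‖ := by
    intro v hv hv0
    obtain ⟨r, hr0, hr⟩ := exists_nonneg_of_mem_principalIdeal hv
    rw [abs_of_nonneg hv0, abs_of_nonneg he0, ← hgsum, Finset.smul_sum] at hr
    obtain ⟨u, hu, rfl⟩ := exists_riesz_decomposition Finset.univ (fun i => r • g i)
      (fun i => smul_nonneg hr0 (hg i)) v hv0 hr
    rw [map_sum, Finset.sum_mul]
    refine Finset.sum_le_sum fun i _ => ?_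
    have hui : u i ≤ ∑ i, u i :=
      Finset.single_le_sum (f := u) (fun j _ => (hu j).1) (Finset.mem_univ i)
    have huL : u i ∈ L := principalSubmodule_of_le hv (hu i).1 hui
    have h1 := hpf i (r • g i - u i)
      ⟨L.sub_mem (L.smul_mem _ (hgL i)) huL, sub_nonneg.2 (hu i).2⟩
    rw [map_sub, map_sub, map_smul, map_smul, smul_eq_mul, smul_eq_mul] at h1
    have h2 := mul_le_mul_of_nonneg_left (hpg i) hr0
    calc f (u i) ≤ p i (u i) := by linarith
      _ ≤ ‖p i‖ * ‖u i‖ := (le_abs_self _).trans ((p i).le_opNorm _)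
      _ ≤ ‖p i‖ * ‖∑ i, u i‖ := by
        refine mul_le_mul_of_nonneg_left (norm_le_norm_of_abs_le_abs ?_) (norm_nonneg _)
        rwa [abs_of_nonneg (hu i).1, abs_of_nonneg hv0]
  have hfabs : ∀ v ∈ L, |f v| ≤ (∑ i, ‖p i‖) * ‖v‖ := by
    intro v hv
    have habs := abs_mem_principalSubmodule hv
    have h1 := hbound |v| habs (abs_nonneg v)
    rw [norm_abs_eq_norm] at h1
    have h2 := hfpos (|v| - v) (L.sub_mem habs hv) (sub_nonneg.2 (le_abs_self v))
    have h3 := hfpos (|v| + v) (L.add_mem habs hv)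
      (neg_le_iff_add_nonneg.1 (neg_le_abs v))
    rw [map_sub] at h2
    rw [map_add] at h3
    exact abs_le.2 ⟨by linarith, by linarith⟩
  obtain ⟨π, hπL, hπp⟩ := exists_extension_dominating e f (∑ i, ‖p i‖) (by positivity) hfabs p
    (fun i v hv hv0 => hpf i v ⟨hv, hv0⟩)
  have hsupp : ∀ i, ∀ ξ ∈ Q i, 0 ≤ ξ → π (a i) ≤ π ξ := fun i ξ hξ hξ0 => by
    rw [hπL _ (haL i)]
    exact (hpQ' i ξ hξ).trans (hπp i ξ hξ0)
  have hπpos : ∀ b, 0 ≤ b → 0 ≤ π b := by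
    intro b hb
    obtain ⟨i⟩ := ‹Nonempty N›
    refine nonneg_of_forall_pos_nonneg_add_mul (D := π (h i) - π (a i)) fun ε hε => ?_
    have hb' : 0 ≤ ε⁻¹ • b := smul_nonneg (inv_nonneg.2 hε.le) hb
    have h1 := hsupp i (h i + ε⁻¹ • b) (hQup i _ (interior_subset (hhQ i)) (hh0 i) _ hb')
      (add_nonneg (hh0 i) hb')
    rw [map_add, map_smul, smul_eq_mul] at h1
    have h2 := mul_le_mul_of_nonneg_left h1 hε.le
    have h3 : ε * (π (h i) + ε⁻¹ * π b) = ε * π (h i) + π b := by field_simp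
    linarith
  refine ⟨π, hπpos, fun i => ⟨(hπpos _ (ha i)).lt_of_ne' fun h0 => ?_, hsupp i⟩⟩
  -- A positive functional vanishing at `a i` vanishes on its closed ideal, which contains `e`,
  -- whereas `π e = 1`.
  have hker : principalIdeal (a i) ⊆ {v | π v = 0} := by
    rintro v ⟨r, hr⟩
    rw [abs_of_nonneg (ha i)] at hr
    have h1 := hπpos _ (sub_nonneg.2 ((le_abs_self v).trans hr))
    have h2 := hπpos _ (sub_nonneg.2 ((neg_le_abs v).trans hr))
    simp only [map_sub, map_smul, map_neg, h0, smul_zero] at h1 h2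
    exact le_antisymm (by linarith) (by linarith)
  have h1 := closure_minimal hker (isClosed_eq π.continuous continuous_const) (had i)
  rw [Set.mem_ofPred_eq, hπL e heL, hfe] at h1
  exact one_ne_zero h1

end Support

/-! ### Strict positivity -/

section Positivity

variable {B : Type*} [NormedAddCommGroup B] [Lattice B] [IsOrderedAddMonoid B]
  [HasSolidNorm B] [NormedSpace ℝ B] [IsOrderedModule ℝ B]

variable (B) in
theorem exists_nonneg_ne_zero [Nontrivial B] : ∃ b : B, 0 ≤ b ∧ b ≠ 0 := by
  obtain ⟨v, hv⟩ := exists_ne (0 : B)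
  exact ⟨|v|, abs_nonneg v, fun h => hv (norm_eq_zero.1 (by rw [← norm_abs_eq_norm, h, norm_zero]))⟩

/-- For small `t > 0` the point `w - t • |v|` stays in the cone, so interior points are order units.
-/
theorem mem_principalIdeal_of_mem_interior {w : B} (hw : w ∈ interior (Set.Ici (0 : B))) (v : B) :
    v ∈ principalIdeal w := by
  have hcont : Filter.Tendsto (fun t : ℝ => w - t • |v|) (nhdsWithin 0 (Set.Ioi 0)) (nhds w) := by
    have : Continuous fun t : ℝ => w - t • |v| := by fun_prop
    have h := this.tendsto 0
    simp only [zero_smul, sub_zero] at h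
    exact h.mono_left nhdsWithin_le_nhds
  have h := (hcont.eventually (mem_interior_iff_mem_nhds.1 hw)).and self_mem_nhdsWithin
  obtain ⟨t, ht, ht0⟩ := h.exists
  have ht0 : 0 < t := ht0
  have hw0 : 0 ≤ w := interior_subset hw
  refine ⟨t⁻¹, ?_⟩
  have h1 := smul_le_smul_of_nonneg_left (sub_nonneg.1 ht) (inv_nonneg.2 ht0.le)
  rwa [smul_smul, inv_mul_cancel₀ ht0.ne', one_smul, ← abs_of_nonneg hw0] at h1

theorem isQuasiInteriorPoint_of_mem_interior {w : B} (hw : w ∈ interior (Set.Ici (0 : B))) :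
    IsQuasiInteriorPoint w := by
  refine ⟨interior_subset hw, ?_⟩
  rw [Set.eq_univ_of_forall (mem_principalIdeal_of_mem_interior hw)]
  exact dense_univ

/-- A nonnegative interior point of `Q` in the closure of an ideal can be moved into the positive
part of the ideal. -/
theorem exists_mem_interior_mem_principalSubmodule {w q : B} {Q : Set B} (hq : q ∈ interior Q)
    (hq0 : 0 ≤ q) (hqw : q ∈ closure (principalIdeal w)) :
    ∃ ξ ∈ interior Q, 0 ≤ ξ ∧ ξ ∈ principalSubmodule w := by
  have hcont : Continuous fun v : B => |v| := by
    simp only [abs]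
    fun_prop
  obtain ⟨v, hv, hvw⟩ := mem_closure_iff.1 hqw _ (isOpen_interior.preimage hcont)
    (by rwa [Set.mem_preimage, abs_of_nonneg hq0])
  exact ⟨|v|, hv, abs_nonneg v, abs_mem_principalSubmodule hvw⟩

end Positivity

namespace PublicEconomy

section Economy

variable {N Y B : Type*} [Fintype N] [NormedAddCommGroup B] [Lattice B] [IsOrderedAddMonoid B]
  [HasSolidNorm B] [NormedSpace ℝ B] [IsOrderedModule ℝ B] {E : PublicEconomy N Y B}

theorem StrictlyPositive.nonneg {w : B} (h : E.StrictlyPositive w) : 0 ≤ w := by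
  rcases h with h | ⟨-, h⟩ | ⟨-, h⟩
  exacts [interior_subset h, h.1, h.1]

theorem StrictlyPositive.principalIdeal_total_subset {w : B} (h : E.StrictlyPositive w) :
    principalIdeal E.total ⊆ closure (principalIdeal w) := by
  rcases h with h | ⟨-, h⟩ | ⟨-, h⟩
  · exact fun v _ => subset_closure (mem_principalIdeal_of_mem_interior h v)
  · rw [h.2.closure_eq]
    exact Set.subset_univ _
  · exact subset_closure.trans h.2.2

/-! ### Preferred sets -/

theorem Desirable.util_mono (hE : E.Desirable) (i : N) (z : Y) {ζ ξ : B} (h0 : 0 ≤ ζ)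
    (h : ζ ≤ ξ) : E.util i ζ z ≤ E.util i ξ z := by
  rcases eq_or_ne ξ ζ with rfl | hne
  · exact le_rfl
  · exact (hE.strongly_monotone i z ξ ζ h0 h hne).le

theorem Desirable.add_mem_preferred (hE : E.Desirable) {i : N} {xi ξ b : B} {y z : Y}
    (hξ : ξ ∈ E.preferred i xi y z) (hb : 0 ≤ b) : ξ + b ∈ E.preferred i xi y z :=
  ⟨add_nonneg hξ.1 hb, hξ.2.trans_le (hE.util_mono i z hξ.1 (le_add_of_nonneg_right hb))⟩

theorem Desirable.add_mem_preferred_of_le (hE : E.Desirable) {i : N} {xi ξ b : B} {y z : Y}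
    (hξ0 : 0 ≤ ξ) (hξ : E.util i xi y ≤ E.util i ξ z) (hb : 0 ≤ b) (hb0 : b ≠ 0) :
    ξ + b ∈ E.preferred i xi y z :=
  ⟨add_nonneg hξ0 hb, hξ.trans_lt (hE.strongly_monotone i z _ _ hξ0 (le_add_of_nonneg_right hb)
    (by simpa using hb0))⟩

theorem Desirable.convex_preferred (hE : E.Desirable) (i : N) (xi : B) (y z : Y) :
    Convex ℝ (E.preferred i xi y z) :=
  (hE.quasiconcave i z).convex_gt (E.util i xi y)

/-- Nonzero preferred bundles are what makes scaling a strict loss, so that monotonicity can recover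
strict preference after mixing. -/
theorem Essential.ne_zero_of_mem_preferred (hess : E.Essential) {i : N} {xi ξ : B} {y z : Y}
    (hxi : 0 ≤ xi) (hξ : ξ ∈ E.preferred i xi y z) : ξ ≠ 0 := by
  rintro rfl
  exact (hess.2 i xi hxi y z).not_gt hξ.2

/-- Utilities are continuous only on the cone, so the path towards `ξ` is restricted to convex
combinations. -/
theorem Desirable.eventually_mem_preferred (hE : E.Desirable) {i : N} {xi ξ w : B} {y z : Y}
    (hξ : ξ ∈ E.preferred i xi y z) (hw : 0 ≤ w) :
    ∀ᶠ t : ℝ in nhdsWithin 1 (Set.Icc 0 1), t • ξ + (1 - t) • w ∈ E.preferred i xi y z := by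
  have hnonneg : ∀ t ∈ Set.Icc (0 : ℝ) 1, 0 ≤ t • ξ + (1 - t) • w := fun t ht =>
    add_nonneg (smul_nonneg ht.1 hξ.1) (smul_nonneg (sub_nonneg.2 ht.2) hw)
  have hcont : Continuous fun t : ℝ => t • ξ + (1 - t) • w := by fun_prop
  have h1 : Filter.Tendsto (fun t : ℝ => t • ξ + (1 - t) • w) (nhdsWithin 1 (Set.Icc 0 1))
      (nhdsWithin ξ (Set.Ici 0)) := by
    refine tendsto_nhdsWithin_iff.2 ⟨?_, Filter.eventually_of_mem self_mem_nhdsWithin hnonneg⟩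
    have := (hcont.tendsto 1).mono_left (nhdsWithin_le_nhds (s := Set.Icc (0 : ℝ) 1))
    simpa using this
  have h2 := (hE.continuous i z ξ hξ.1).eventually (lt_mem_nhds hξ.2)
  filter_upwards [h1.eventually h2, self_mem_nhdsWithin] with t ht ht01
  exact ⟨hnonneg t ht01, ht⟩

theorem Desirable.exists_smul_mem_preferred (hE : E.Desirable) {i : N} {xi ξ : B} {y z : Y}
    (hξ : ξ ∈ E.preferred i xi y z) : ∃ t ∈ Set.Ioo (0 : ℝ) 1, t • ξ ∈ E.preferred i xi y z := by
  have h := (hE.eventually_mem_preferred hξ le_rfl).filter_mono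
    (nhdsWithin_mono (1 : ℝ) Set.Ioo_subset_Icc_self)
  have : (nhdsWithin (1 : ℝ) (Set.Ioo 0 1)).NeBot := right_nhdsWithin_Ioo_neBot one_pos
  obtain ⟨t, ht, ht01⟩ := (h.and self_mem_nhdsWithin).exists
  exact ⟨t, ht01, by simpa using ht⟩

/-- A proper mixture of a strictly preferred and a weakly preferred bundle is strictly
preferred. -/
theorem Desirable.mix_mem_preferred (hE : E.Desirable) (hess : E.Essential) {i : N} {xi ξ w : B}
    {y z : Y} (hxi : 0 ≤ xi) (hξ : ξ ∈ E.preferred i xi y z) (hw0 : 0 ≤ w)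
    (hw : E.util i xi y ≤ E.util i w z) {r q : ℝ} (hr : 0 < r) (hq : 0 ≤ q) (hrq : r + q = 1) :
    r • ξ + q • w ∈ E.preferred i xi y z := by
  -- Quasi-concavity alone gives weak preference. Mixing with `t • ξ` instead leaves a nonzero
  -- remainder `(r * (1 - t)) • ξ`, and adding it back gives strictness.
  obtain ⟨t, ht, htξ⟩ := hE.exists_smul_mem_preferred hξ
  have h1 := hE.quasiconcave i z (E.util i xi y) ⟨htξ.1, htξ.2.le⟩ ⟨hw0, hw⟩ hr.le hq hrq
  have h2 := hE.add_mem_preferred_of_le (b := (r * (1 - t)) • ξ) h1.1 h1.2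
    (smul_nonneg (mul_nonneg hr.le (sub_nonneg.2 ht.2.le)) hξ.1)
    (smul_ne_zero (mul_pos hr (sub_pos.2 ht.2)).ne' (hess.ne_zero_of_mem_preferred hxi hξ))
  convert h2 using 1
  module

/-- In each of the three regimes the preferred sets are traces on the positive cone of convex sets
whose interior meets the positive part of the ideal generated by a strictly positive `w`. -/
theorem ConeRegime.exists_proper_extension [Nontrivial B] (hregime : E.ConeRegime)
    (hE : E.Desirable) {w : B} (hw : E.StrictlyPositive w) {x : N → B} {y : Y}
    (hx : E.ParetoOptimal x y) (i : N) (z : Y) {g : B} (hg0 : 0 ≤ g)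
    (hg : E.util i (x i) y ≤ E.util i g z) :
    ∃ Q : Set B, Convex ℝ Q ∧ Q ∩ Set.Ici 0 = E.preferred i (x i) y z ∧
      ∃ ξ ∈ interior Q, 0 ≤ ξ ∧ ξ ∈ principalSubmodule w := by
  rcases hregime with hint | ⟨hint, hq, hprop⟩ | ⟨hq, hprop⟩
  -- With an interior cone point no properness is needed: the preferred set contains a translate of
  -- the cone.
  · refine ⟨E.preferred i (x i) y z, hE.convex_preferred _ _ _ _,
      Set.inter_eq_left.2 fun ξ hξ => hξ.1, ?_⟩
    have hwi : w ∈ interior (Set.Ici (0 : B)) := by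
      rcases hw with h | ⟨h, -⟩ | ⟨h, -⟩
      · exact h
      · exact absurd hint (by rw [h]; exact Set.not_nonempty_empty)
      · exact absurd ⟨_, isQuasiInteriorPoint_of_mem_interior hint.some_mem⟩ h
    obtain ⟨v, hv0, hv⟩ := exists_nonneg_ne_zero B
    have hgv := hE.add_mem_preferred_of_le hg0 hg hv0 hv
    have hsub : (fun b => g + v + b) '' interior (Set.Ici 0) ⊆
        interior (E.preferred i (x i) y z) := by
      refine interior_maximal ?_ ((Homeomorph.addLeft (g + v)).isOpenMap _ isOpen_interior)
      rintro _ ⟨b, hb, rfl⟩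
      exact hE.add_mem_preferred hgv (interior_subset hb)
    exact ⟨g + v + w, hsub ⟨w, hwi, rfl⟩, add_nonneg hgv.1 hw.nonneg,
      mem_principalIdeal_of_mem_interior hwi _⟩
  · obtain ⟨Q, hQ, -, hQP, q, hqQ, hq0⟩ := hprop x y hx i z
    refine ⟨Q, hQ, hQP, exists_mem_interior_mem_principalSubmodule hqQ hq0 ?_⟩
    rcases hw with h | ⟨-, h⟩ | ⟨h, -⟩
    · rw [hint] at h
      exact h.elim
    · exact h.2 q
    · exact absurd hq h
  · obtain ⟨Q, hQ, -, hQP, q, ⟨hqQ, hq0⟩, hqe⟩ := hprop x y hx i z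
    exact ⟨Q, hQ, hQP, exists_mem_interior_mem_principalSubmodule hqQ hq0
      (hw.principalIdeal_total_subset hqe)⟩

end Economy

/-! ### Accounting identities -/

section Accounting

variable {N Y B : Type*} [Fintype N] [NormedAddCommGroup B] [Lattice B] [NormedSpace ℝ B]
  {E : PublicEconomy N Y B}

theorem aubin_balance_iff (σ : Finset N → Y → ℝ) (β : N → ℝ) (z : Y) (ξ : N → B) :
    ∑ i, β i • ξ i + aubinContribution σ β z • E.cost z = ∑ i, β i • E.endow i ↔
      ∑ i, β i • (ξ i - (E.endow i - σ {i} z • E.cost z)) = 0 := by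
  rw [← sub_eq_zero, aubinContribution, Finset.sum_smul, ← Finset.sum_add_distrib,
    ← Finset.sum_sub_distrib]
  refine iff_of_eq (congrArg (· = 0) (Finset.sum_congr rfl fun i _ => ?_))
  module

theorem replica_balance_iff (σ : Finset N → Y → ℝ) {r : ℕ} (hr : 0 < r) (S : Finset (N × Fin r))
    (z : Y) (ξ : N × Fin r → B) :
    ∑ p ∈ S, ξ p + replicaContribution σ r S z • (E.replica r).cost z =
        ∑ p ∈ S, (E.replica r).endow p ↔
      ∑ p ∈ S, (ξ p - (E.endow p.1 - σ {p.1} z • E.cost z)) = 0 := by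
  have hr' : (r : ℝ) ≠ 0 := by positivity
  rw [← sub_eq_zero, replicaContribution, Finset.sum_smul, ← Finset.sum_add_distrib,
    ← Finset.sum_sub_distrib]
  refine iff_of_eq (congrArg (· = 0) (Finset.sum_congr rfl fun p _ => ?_))
  simp only [replica]
  rw [smul_smul, div_mul_cancel₀ _ hr']
  module

theorem perturbed_balance_iff {ρ : N → Y → ℝ} {z : Y} (hρ : ∑ i, ρ i z = 1) (g : N → B)
    (α : N → ℝ) (ξ : N → B) :
    ∑ i, ξ i + (E.perturbed ρ g z α).cost z = ∑ i, (E.perturbed ρ g z α).endow i ↔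
      ∑ i, (ξ i - (E.endow i - ρ i z • E.cost z) -
        (1 - α i) • (g i - (E.endow i - ρ i z • E.cost z))) = 0 := by
  have hc : E.cost z = ∑ i, ρ i z • E.cost z := by rw [← Finset.sum_smul, hρ, one_smul]
  simp only [perturbed]
  nth_rewrite 1 [hc]
  rw [← sub_eq_zero, ← Finset.sum_add_distrib, ← Finset.sum_sub_distrib]
  refine iff_of_eq (congrArg (· = 0) (Finset.sum_congr rfl fun i _ => ?_))
  module

theorem IsFeasible.sum_sub_eq_zero {ρ : N → Y → ℝ} {z : Y} (hρ : ∑ i, ρ i z = 1) {g : N → B}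
    (hg : E.IsFeasible g z) : ∑ i, (g i - (E.endow i - ρ i z • E.cost z)) = 0 := by
  rw [Finset.sum_sub_distrib, Finset.sum_sub_distrib, ← Finset.sum_smul, hρ, one_smul, ← hg.2]
  abel

end Accounting

end PublicEconomy

/-! ### Cost shares induced by a contribution measure -/

theorem IsContributionMeasure.sum_singleton {N Y : Type*} [Fintype N] [DecidableEq N]
    {σ : Finset N → Y → ℝ} (hσ : IsContributionMeasure σ) {S : Finset N} (hS : S.Nonempty) (z : Y) :
    ∑ i ∈ S, σ {i} z = σ S z := by
  induction hS using Finset.Nonempty.cons_induction with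
  | singleton i => simp
  | cons i S hi hS ih =>
    rw [Finset.sum_cons, ih, ← hσ.additive {i} S (Finset.singleton_nonempty i) hS
      (by simpa using hi), Finset.cons_eq_insert, Finset.insert_eq]

theorem IsContributionMeasure.isCostDistribution {N Y : Type*} [Fintype N] [DecidableEq N]
    [Nonempty N] {σ : Finset N → Y → ℝ} (hσ : IsContributionMeasure σ) :
    IsCostDistribution (costDistributionOf σ) :=
  ⟨fun i y => hσ.mem_Icc {i} (Finset.singleton_nonempty i) y,
    fun y => (hσ.sum_singleton Finset.univ_nonempty y).trans (hσ.univ_eq_one y)⟩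

namespace PublicEconomy

/-! ### Equilibria, Aubin blocking and perturbed endowments -/

section Equivalences

variable {N Y B : Type*} [Fintype N] [NormedAddCommGroup B] [Lattice B] [IsOrderedAddMonoid B]
  [HasSolidNorm B] [NormedSpace ℝ B] [IsOrderedModule ℝ B] {E : PublicEconomy N Y B}

/-- A preferred bundle is unaffordable, so each active net trade has positive value at `π z`, while
their weighted sum is zero. -/
theorem IsCostShareEquilibrium.inAubinCore {σ : Finset N → Y → ℝ} {x : N → B} {y : Y}
    (h : E.IsCostShareEquilibrium (costDistributionOf σ) x y) : E.InAubinCore σ x y := by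
  obtain ⟨hx, -, π, -, hπ⟩ := h
  refine ⟨hx, ?_⟩
  rintro β ⟨hβ, j, hj⟩ ⟨z, ξ, hξ0, hξ, heq⟩
  rw [aubin_balance_iff] at heq
  have hpos : ∀ i, 0 < β i → 0 < π z (ξ i - (E.endow i - σ {i} z • E.cost z)) := by
    intro i hi
    by_contra! hle
    refine ((hπ i).2 (ξ i, z) ⟨hξ0 i, ?_⟩).not_gt (hξ i hi)
    simp only [map_sub, map_smul, smul_eq_mul] at hle
    simp only [costDistributionOf]
    linarith
  have hsum : 0 < ∑ i, β i * π z (ξ i - (E.endow i - σ {i} z • E.cost z)) := by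
    refine Finset.sum_pos' (fun i _ => ?_) ⟨j, Finset.mem_univ j, mul_pos hj (hpos j hj)⟩
    rcases (hβ i).1.eq_or_lt with h0 | h0
    · rw [← h0, zero_mul]
    · exact (mul_pos h0 (hpos i h0)).le
  have h0 := congrArg (π z) heq
  simp only [map_sum, map_zero, map_smul, smul_eq_mul] at h0
  exact hsum.ne' h0

theorem InAubinCore.aubinNonDominated {σ : Finset N → Y → ℝ} {x : N → B} {y : Y}
    (h : E.InAubinCore σ x y) : E.AubinNonDominated σ x y :=
  ⟨h.1, fun β hβ _ => h.2 β hβ⟩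

/-- The rates of a dominating coalition of all agents need not be bounded by one. -/
theorem AubinNonDominated.sum_ne_zero [Nonempty N] {σ : Finset N → Y → ℝ} {x : N → B} {y : Y}
    (h : E.AubinNonDominated σ x y) {z : Y} {β : N → ℝ} (hβ : ∀ i, 0 < β i) {ξ : N → B}
    (hξ : ∀ i, ξ i ∈ E.preferred i (x i) y z) :
    ∑ i, β i • (ξ i - (E.endow i - σ {i} z • E.cost z)) ≠ 0 := by
  intro h0
  have hs : 0 < ∑ i, β i := Finset.sum_pos (fun i _ => hβ i) Finset.univ_nonempty
  have hpos : ∀ i, 0 < β i / ∑ i, β i := fun i => div_pos (hβ i) hs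
  have hle : ∀ i, β i / ∑ i, β i ≤ 1 := fun i => (div_le_one hs).2
    (Finset.single_le_sum (f := β) (fun j _ => (hβ j).le) (Finset.mem_univ i))
  obtain ⟨j⟩ := ‹Nonempty N›
  refine h.2 (fun i => β i / ∑ i, β i) ⟨fun i => ⟨(hpos i).le, hle i⟩, j, hpos j⟩ hpos
    ⟨z, ξ, fun i => (hξ i).1, fun i _ => (hξ i).2, ?_⟩
  rw [aubin_balance_iff]
  simp only [div_eq_inv_mul, mul_smul]
  rw [← Finset.smul_sum, h0, smul_zero]

/-- Prices at which every bundle preferred by an agent, together with the project `z`, costs more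
than the endowment of the agent net of the cost share. -/
theorem AubinNonDominated.exists_price [Nonempty N] [Nontrivial B] {σ : Finset N → Y → ℝ}
    {x : N → B} {y : Y} (h : E.AubinNonDominated σ x y) (hE : E.IsEconomy) (hess : E.Essential)
    (hregime : E.ConeRegime) (hx : E.ParetoOptimal x y) {z : Y} (hσ : ∑ i, σ {i} z = 1)
    (hpos : ∀ i, E.StrictlyPositive (E.endow i - σ {i} z • E.cost z)) {g : N → B}
    (hg : E.IsFeasible g z) (hgx : ∀ i, E.util i (x i) y ≤ E.util i (g i) z) :
    ∃ π : B →L[ℝ] ℝ, (∀ b, 0 ≤ b → 0 ≤ π b) ∧ ∀ i, ∀ ξ ∈ E.preferred i (x i) y z,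
      π (E.endow i - σ {i} z • E.cost z) < π ξ := by
  have hd := hE.desirable
  set a : N → B := fun i => E.endow i - σ {i} z • E.cost z with ha
  have hsum : ∑ i, a i = E.total - E.cost z := by
    rw [ha, Finset.sum_sub_distrib, ← Finset.sum_smul, hσ, one_smul, total]
  have hw : E.StrictlyPositive (∑ i, a i) := hsum ▸ hE.total_sub_cost_pos z
  have hgsum : ∑ i, g i = ∑ i, a i := by
    rw [hsum, total, ← hg.2]
    abel
  have htotal : ∑ i, a i ∈ principalIdeal E.total := by
    refine principalSubmodule_of_le (self_mem_principalSubmodule E.total) hw.nonneg ?_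
    rw [hsum]
    exact sub_le_self _ (hE.cost_nonneg z)
  choose Q hQ hQP q hqQ hq0 hqL using fun i =>
    hregime.exists_proper_extension hd hw hx i z (hg.1 i) (hgx i)
  have hPQ : ∀ i ξ, ξ ∈ E.preferred i (x i) y z ↔ ξ ∈ Q i ∧ 0 ≤ ξ := fun i ξ => by
    rw [← hQP]; rfl
  -- Otherwise the ideal is trivial and the preferred bundle `q i` is zero, against essentiality.
  have ha0 : ∑ i, a i ≠ 0 := by
    intro h0
    obtain ⟨i⟩ := ‹Nonempty N›
    obtain ⟨r, hr⟩ := hqL i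
    rw [h0, abs_zero, smul_zero, abs_of_nonneg (hq0 i)] at hr
    exact hess.ne_zero_of_mem_preferred (hx.1.1 i)
      ((hPQ i _).2 ⟨interior_subset (hqQ i), hq0 i⟩) (le_antisymm hr (hq0 i))
  obtain ⟨π, hπ0, hπ⟩ := exists_supporting_price a (fun i => (hpos i).nonneg) ha0
    (fun i => (hpos i).principalIdeal_total_subset htotal) Q hQ
    (fun i ξ hξ hξ0 b hb => ((hPQ i _).1 (hd.add_mem_preferred ((hPQ i ξ).2 ⟨hξ, hξ0⟩) hb)).1)
    (fun i => ⟨q i, hqQ i, hq0 i, hqL i⟩) g hg.1 hgsum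
    (fun i ε hε => ((hPQ i _).1 (hd.add_mem_preferred_of_le (hg.1 i) (hgx i)
      (smul_nonneg hε.le hw.nonneg) (smul_ne_zero hε.ne' ha0))).1)
    (fun β hβ ξ hξ => h.sum_ne_zero hβ fun i => (hPQ i _).2 (hξ i))
  refine ⟨π, hπ0, fun i ξ hξ => ?_⟩
  obtain ⟨t, ht, htξ⟩ := hd.exists_smul_mem_preferred hξ
  have h1 := (hπ i).2 _ ((hPQ i _).1 htξ).1 htξ.1
  have h2 := (hπ i).1
  rw [map_smul, smul_eq_mul] at h1
  have h3 : 0 < π ξ := pos_of_mul_pos_right (h2.trans_le h1) ht.1.le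
  nlinarith [ht.2]

theorem AubinNonDominated.isCostShareEquilibrium [Nonempty N] {σ : Finset N → Y → ℝ}
    {x : N → B} {y : Y} (h : E.AubinNonDominated σ x y) (hE : E.IsEconomy) (hess : E.Essential)
    (hregime : E.ConeRegime) (hx : E.ParetoOptimal x y)
    (hσ : IsCostDistribution (costDistributionOf σ))
    (hpos : ∀ i z, E.StrictlyPositive (E.endow i - σ {i} z • E.cost z)) {g : Y → N → B}
    (hg : ∀ z, E.IsFeasible (g z) z ∧ ∀ i, E.util i (x i) y ≤ E.util i (g z i) z) :
    E.IsCostShareEquilibrium (costDistributionOf σ) x y := by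
  refine ⟨hx.1, hσ, ?_⟩
  -- If `B` is trivial there is no direction of strict improvement; zero prices work by
  -- essentiality.
  rcases subsingleton_or_nontrivial B with hB | hB
  · refine ⟨fun _ => 0, fun _ _ _ => le_rfl, fun i => ⟨⟨hx.1.1 i, by simp⟩, ?_⟩⟩
    rintro ⟨ξ, z⟩ -
    rw [Subsingleton.elim ξ 0]
    exact hess.2 i (x i) (hx.1.1 i) y z
  choose π hπ0 hπ using fun z =>
    h.exists_price hE hess hregime hx (hσ.2 z) (fun i => hpos i z) (hg z).1 (hg z).2
  obtain ⟨b, hb, hb0⟩ := exists_nonneg_ne_zero B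
  -- `x i` is a limit of preferred bundles; feasibility then turns these inequalities into
  -- equalities, so `x i` is affordable.
  have hle : ∀ i ∈ Finset.univ, π y (E.endow i - σ {i} y • E.cost y) ≤ π y (x i) := by
    intro i _
    refine sub_nonneg.1 (nonneg_of_forall_pos_nonneg_add_mul (D := π y b) fun ε hε => ?_)
    have := hπ y i _ (hE.desirable.add_mem_preferred_of_le (hx.1.1 i) le_rfl
      (smul_nonneg hε.le hb) (smul_ne_zero hε.ne' hb0))
    rw [map_add, map_smul, smul_eq_mul] at this
    linarith
  have hsum := congrArg (π y) (hx.1.sum_sub_eq_zero (hσ.2 y))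
  simp only [map_sum, map_zero, costDistributionOf] at hsum
  have heq : ∀ i, π y (E.endow i - σ {i} y • E.cost y) = π y (x i) := fun i =>
    (Finset.sum_eq_sum_iff_of_le hle).1 (by
      rw [← sub_eq_zero, ← neg_eq_zero, neg_sub, ← Finset.sum_sub_distrib, ← hsum]
      exact Finset.sum_congr rfl fun j _ => (map_sub _ _ _).symm) i (Finset.mem_univ i)
  refine ⟨π, hπ0, fun i => ⟨⟨hx.1.1 i, ?_⟩, ?_⟩⟩
  · have := heq i
    simp only [map_sub, map_smul, smul_eq_mul] at this
    simp only [costDistributionOf]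
    linarith
  · rintro ⟨ξ, z⟩ ⟨hξ0, hξ⟩
    by_contra! hlt
    have := hπ z i ξ ⟨hξ0, hlt⟩
    simp only [map_sub, map_smul, smul_eq_mul] at this
    simp only [costDistributionOf] at hξ
    linarith

/-- Adding the balance of `g` to the perturbed balance leaves `(ξ i - a i) + α i • (g i - a i)`,
which is `1 + α i` times the net trade of a mixture of `ξ i` and `g i`. -/
theorem AubinNonDominated.not_zDominated_perturbed [Nonempty N] {σ : Finset N → Y → ℝ}
    {x : N → B} {y : Y} (h : E.AubinNonDominated σ x y) (hE : E.Desirable) (hess : E.Essential)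
    {z : Y} (hσ : ∑ i, costDistributionOf σ i z = 1) {g : N → B} (hg : E.IsFeasible g z)
    (hgx : ∀ i, E.util i (x i) y ≤ E.util i (g i) z) {α : N → ℝ} (hα : ∀ i, 0 ≤ α i) :
    ¬ (E.perturbed (costDistributionOf σ) g z α).ZDominated x y z := by
  rintro ⟨ξ, ⟨hξ0, hξeq⟩, hξ⟩
  rw [perturbed_balance_iff hσ] at hξeq
  have hα' : ∀ i, 0 < 1 + α i := fun i => by linarith [hα i]
  refine h.sum_ne_zero hα' (ξ := fun i => (1 / (1 + α i)) • ξ i + (α i / (1 + α i)) • g i)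
    (fun i => hE.mix_mem_preferred hess (h.1.1 i) ⟨hξ0 i, hξ i⟩ (hg.1 i) (hgx i)
      (one_div_pos.2 (hα' i)) (div_nonneg (hα i) (hα' i).le)
      (by rw [← add_div, div_self (hα' i).ne'])) ?_
  refine Eq.trans ?_ ((congrArg₂ (· + ·) hξeq (hg.sum_sub_eq_zero hσ)).trans (add_zero 0))
  rw [← Finset.sum_add_distrib]
  refine Finset.sum_congr rfl fun i _ => ?_
  simp only [costDistributionOf]
  set a := E.endow i - σ {i} z • E.cost z
  have := (hα' i).ne'
  match_scalars <;> field_simp <;> ring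

/-- Participation at rate `β i` amounts to consuming `β i • ξ i + (1 - β i) • g z i` in the economy
with `α = β`. -/
theorem aubinNonDominated_of_forall_not_zDominated_perturbed {σ : Finset N → Y → ℝ}
    {x : N → B} {y : Y} (hx : E.IsFeasible x y) (hE : E.Desirable) (hess : E.Essential)
    (hσ : ∀ z, ∑ i, costDistributionOf σ i z = 1) {g : Y → N → B}
    (hg : ∀ z, E.IsFeasible (g z) z ∧ ∀ i, E.util i (x i) y ≤ E.util i (g z i) z)
    (h : ∀ z, ∀ α : N → ℝ, (∀ i, α i ∈ Set.Icc (0 : ℝ) 1) →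
      ¬ (E.perturbed (costDistributionOf σ) (g z) z α).ZDominated x y z) :
    E.AubinNonDominated σ x y := by
  refine ⟨hx, ?_⟩
  rintro β ⟨hβ, -⟩ hβ0 ⟨z, ξ, hξ0, hξ, heq⟩
  rw [aubin_balance_iff] at heq
  have hmix : ∀ i, β i • ξ i + (1 - β i) • g z i ∈ E.preferred i (x i) y z := fun i =>
    hE.mix_mem_preferred hess (hx.1 i) ⟨hξ0 i, hξ i (hβ0 i)⟩ ((hg z).1.1 i) ((hg z).2 i) (hβ0 i)
      (sub_nonneg.2 (hβ i).2) (by ring)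
  refine h z β hβ ⟨fun i => β i • ξ i + (1 - β i) • g z i, ⟨fun i => (hmix i).1, ?_⟩,
    fun i => (hmix i).2⟩
  rw [perturbed_balance_iff (hσ z), ← heq]
  refine Finset.sum_congr rfl fun i _ => ?_
  simp only [costDistributionOf]
  module

/-! ### Replica economies -/

theorem IsFeasible.replica {x : N → B} {y : Y} (hx : E.IsFeasible x y) (r : ℕ) :
    (E.replica r).IsFeasible (fun p => x p.1) y := by
  refine ⟨fun p => hx.1 p.1, ?_⟩
  simp only [PublicEconomy.replica, Fintype.sum_prod_type, Finset.sum_const, Finset.card_univ,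
    Fintype.card_fin, ← Nat.cast_smul_eq_nsmul ℝ, ← Finset.smul_sum, ← smul_add, hx.2]

theorem sum_eq_sum_filter_mem {M : Type*} [AddCommMonoid M] [DecidableEq N] {r : ℕ}
    (S : Finset (N × Fin r)) (F : N × Fin r → M) :
    ∑ p ∈ S, F p = ∑ i, ∑ j ∈ Finset.univ.filter (fun j => (i, j) ∈ S), F (i, j) :=
  Finset.sum_finset_product S Finset.univ _ (by simp)

theorem InAubinCore.isEdgeworthEquilibrium [DecidableEq N] {σ : Finset N → Y → ℝ} {x : N → B}
    {y : Y} (h : E.InAubinCore σ x y) (hE : E.Desirable) :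
    E.IsEdgeworthEquilibrium σ x y := by
  refine ⟨h.1, fun r hr => ⟨h.1.replica r, ?_⟩⟩
  rintro S ⟨⟨i₀, j₀⟩, hS⟩ ⟨z, ξ, hξ0, hξ, heq⟩
  rw [replica_balance_iff σ hr, sum_eq_sum_filter_mem] at heq
  have hr' : (0 : ℝ) < r := by exact_mod_cast hr
  let C : N → Finset (Fin r) := fun i => Finset.univ.filter fun j => (i, j) ∈ S
  have hC : ∀ i j, j ∈ C i ↔ (i, j) ∈ S := fun i j => by simp [C]
  have hCr : ∀ i, ((C i).card : ℝ) ≤ r := fun i => by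
    exact_mod_cast (Finset.card_le_univ (C i)).trans_eq (Fintype.card_fin r)
  have hC0 : 0 < (C i₀).card := Finset.card_pos.2 ⟨j₀, (hC _ _).2 hS⟩
  refine h.2 (fun i => (C i).card / r) ⟨fun i => ⟨by positivity, (div_le_one hr').2 (hCr i)⟩, i₀,
    div_pos (by exact_mod_cast hC0) hr'⟩ ⟨z, fun i => ∑ j ∈ C i, ((C i).card : ℝ)⁻¹ • ξ (i, j),
    fun i => Finset.sum_nonneg fun j _ => smul_nonneg (by positivity) (hξ0 _),
    fun i hi => ?_, ?_⟩
  · have hi' : (0 : ℝ) < (C i).card := by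
      by_contra! hle
      exact hi.not_ge (div_nonpos_of_nonpos_of_nonneg hle hr'.le)
    refine ((hE.convex_preferred i (x i) y z).sum_mem (fun _ _ => by positivity) ?_
      fun j hj => ⟨hξ0 _, hξ (i, j) ((hC i j).1 hj)⟩ :
        ∑ j ∈ C i, ((C i).card : ℝ)⁻¹ • ξ (i, j) ∈ E.preferred i (x i) y z).2
    rw [Finset.sum_const, nsmul_eq_mul, mul_inv_cancel₀ hi'.ne']
  · rw [aubin_balance_iff, ← smul_zero (r : ℝ)⁻¹, ← heq, Finset.smul_sum]
    refine Finset.sum_congr rfl fun i _ => ?_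
    change _ = (r : ℝ)⁻¹ • ∑ j ∈ C i, (ξ (i, j) - (E.endow i - σ {i} z • E.cost z))
    rw [Finset.sum_sub_distrib, Finset.sum_const, ← Nat.cast_smul_eq_nsmul ℝ,
      ← Finset.smul_sum, smul_sub, smul_sub, smul_smul, smul_smul]
    -- Types absent from the coalition have rate zero and an empty average.
    rcases eq_or_ne ((C i).card : ℝ) 0 with h0 | h0
    · have : C i = ∅ := Finset.card_eq_zero.1 (by exact_mod_cast h0)
      simp [this]
    · match_scalars <;> field_simp

theorem IsEdgeworthEquilibrium.inAubinCore [DecidableEq N] {σ : Finset N → Y → ℝ} {x : N → B}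
    {y : Y} (h : E.IsEdgeworthEquilibrium σ x y) (hE : E.Desirable)
    (hpos : ∀ i z, 0 ≤ E.endow i - σ {i} z • E.cost z) : E.InAubinCore σ x y := by
  refine ⟨h.1, ?_⟩
  rintro β ⟨hβ, i₀, hi₀⟩ ⟨z, ξ, hξ0, hξ, heq⟩
  rw [aubin_balance_iff] at heq
  let a : N → B := fun i => E.endow i - σ {i} z • E.cost z
  -- In the `k`-fold replica, `m k i` agents of type `i` join. Shrinking their net trades by `t k i`
  -- offsets the rounding, and `t k i → 1` keeps the bundles preferred.
  let m : ℕ → N → ℕ := fun k i => ⌈β i * k⌉₊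
  let t : ℕ → N → ℝ := fun k i => β i * k / m k i
  have hmle : ∀ k i, β i * k ≤ m k i := fun k i => Nat.le_ceil _
  have ht01 : ∀ k i, t k i ∈ Set.Icc (0 : ℝ) 1 := fun k i =>
    ⟨div_nonneg (mul_nonneg (hβ i).1 k.cast_nonneg) (Nat.cast_nonneg _),
      div_le_one_of_le₀ (hmle k i) (Nat.cast_nonneg _)⟩
  have htend : ∀ i, 0 < β i → Filter.Tendsto (fun k => t k i) Filter.atTop
      (nhdsWithin 1 (Set.Icc 0 1)) := by
    intro i hi
    refine tendsto_nhdsWithin_iff.2 ⟨?_, Filter.Eventually.of_forall fun k => ht01 k i⟩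
    have h1 := (tendsto_const_nhds (x := β i)).div ((tendsto_nat_ceil_mul_div_atTop hi.le).comp
      (tendsto_natCast_atTop_atTop (R := ℝ))) hi.ne'
    rw [div_self hi.ne'] at h1
    refine h1.congr fun k => ?_
    simp only [Pi.div_apply, Function.comp_apply, t, m]
    rw [div_div_eq_mul_div]
  have hev : ∀ᶠ k : ℕ in Filter.atTop, ∀ i, 0 < β i →
      t k i • ξ i + (1 - t k i) • a i ∈ E.preferred i (x i) y z := by
    refine Filter.eventually_all.2 fun i => ?_
    by_cases hi : 0 < β i
    · filter_upwards [(htend i hi).eventually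
        (hE.eventually_mem_preferred ⟨hξ0 i, hξ i hi⟩ (hpos i z))] with k hk _ using hk
    · exact Filter.Eventually.of_forall fun k hi' => absurd hi' hi
  obtain ⟨k, hk, hk0⟩ := (hev.and (Filter.eventually_gt_atTop 0)).exists
  have hk' : (0 : ℝ) < k := by exact_mod_cast hk0
  have hmk : ∀ i, m k i ≤ k := fun i => Nat.ceil_le.2 (by nlinarith [(hβ i).2])
  let S : Finset (N × Fin k) := Finset.univ.filter fun p => p.2.1 < m k p.1
  have hS : ∀ p, p ∈ S ↔ p.2.1 < m k p.1 := fun p => by simp [S]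
  have hβS : ∀ p ∈ S, 0 < β p.1 := by
    intro p hp
    have h1 : 0 < m k p.1 := (Nat.zero_le _).trans_lt ((hS p).1 hp)
    exact pos_of_mul_pos_left (Nat.ceil_pos.1 h1) hk'.le
  have hm₀ : 0 < m k i₀ := Nat.ceil_pos.2 (mul_pos hi₀ hk')
  refine (h.2 k hk0).2 S ⟨(i₀, ⟨0, hk0⟩), (hS _).2 hm₀⟩
    ⟨z, fun p => t k p.1 • ξ p.1 + (1 - t k p.1) • a p.1, fun p => ?_, fun p hp => ?_, ?_⟩
  · exact add_nonneg (smul_nonneg (ht01 k p.1).1 (hξ0 p.1))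
      (smul_nonneg (sub_nonneg.2 (ht01 k p.1).2) (hpos p.1 z))
  · exact (hk p.1 (hβS p hp)).2
  · rw [replica_balance_iff σ hk0, sum_eq_sum_filter_mem, ← smul_zero (k : ℝ), ← heq,
      Finset.smul_sum]
    refine Finset.sum_congr rfl fun i _ => ?_
    have hcard : (Finset.univ.filter fun j : Fin k => (i, j) ∈ S).card = m k i := by
      simp only [hS]
      rw [Fin.card_filter_val_lt, min_eq_right (hmk i)]
    have htm : (m k i : ℝ) * t k i = k * β i := by
      -- If `m k i = 0` then `t k i` is a division by zero, but `β i * k = 0` as well.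
      rcases eq_or_ne (m k i : ℝ) 0 with h0 | h0
      · have h1 := hmle k i
        have h2 := (hβ i).1
        rw [h0] at h1 ⊢
        nlinarith [mul_nonneg h2 hk'.le]
      · simp only [t]
        field_simp
    dsimp only
    rw [Finset.sum_const, hcard, ← Nat.cast_smul_eq_nsmul ℝ, smul_smul, ← htm]
    change _ = ((m k i : ℝ) * t k i) • (ξ i - a i)
    change (m k i : ℝ) • (t k i • ξ i + (1 - t k i) • a i - a i) = _
    module

end Equivalences

end PublicEconomy

theorem theorem5 {N Y B : Type*} [Fintype N] [DecidableEq N] [Nonempty N]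
    [NormedAddCommGroup B] [Lattice B] [IsOrderedAddMonoid B] [HasSolidNorm B]
    [NormedSpace ℝ B] [IsOrderedModule ℝ B] [CompleteSpace B]
    (E : PublicEconomy N Y B) (hE : E.IsEconomy) (hess : E.Essential)
    (hint : E.IntegrableUtilities) (hregime : E.ConeRegime)
    (σ : Finset N → Y → ℝ) (hσ : IsContributionMeasure σ)
    (hpos : ∀ i z, E.StrictlyPositive (E.endow i - σ {i} z • E.cost z))
    (x : N → B) (y : Y) (hx : E.ParetoOptimal x y)
    (γ : Y → N → B)
    (hγ : ∀ z, E.IsFeasible (γ z) z ∧ ∀ i, E.util i (x i) y ≤ E.util i (γ z i) z) :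
    List.TFAE [
      E.IsCostShareEquilibrium (costDistributionOf σ) x y,
      E.InAubinCore σ x y,
      E.AubinNonDominated σ x y,
      E.IsEdgeworthEquilibrium σ x y,
      ∀ z, ∀ α : N → ℝ, (∀ i, α i ∈ Set.Icc (0 : ℝ) 1) →
        ¬ (E.perturbed (costDistributionOf σ) (γ z) z α).ZDominated x y z] := by
  have hρ := hσ.isCostDistribution
  have hd := hE.desirable
  tfae_have 1 → 2 := fun h => h.inAubinCore
  tfae_have 2 → 3 := fun h => h.aubinNonDominated
  tfae_have 3 → 1 := fun h => h.isCostShareEquilibrium hE hess hregime hx hρ hpos hγ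
  tfae_have 2 → 4 := fun h => h.isEdgeworthEquilibrium hd
  tfae_have 4 → 2 := fun h => h.inAubinCore hd fun i z => (hpos i z).nonneg
  tfae_have 3 → 5 := fun h z α hα => h.not_zDominated_perturbed hd hess (hρ.2 z) (hγ z).1 (hγ z).2
    fun i => (hα i).1
  tfae_have 5 → 3 := fun h =>
    PublicEconomy.aubinNonDominated_of_forall_not_zDominated_perturbed hx.1 hd hess hρ.2 hγ h
  tfae_finish
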